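/- Let $e\ge 2$ and $l\ge 1$ be integers. **Symbols and quotients.** For a partition $\lambda=(\lambda_1\ge\lambda_2\ge\cdots)$ (with $\lambda_a=0$ for large $a$) and $m\in\mathbb Z$, let $X^m(\lambda)=\{\lambda_a-a+m : a\ge 1\}\subset\mathbb Z$, the symbol of charge $m$ of $\lambda$. The map $(\lambda,m)\mapsto X^m(\lambda)$ is a bijection onto the symbols, that is, the sets of integers that are bounded above and contain all sufficiently small integers. So a tuple of $n$ symbols is the same as an $n$-partition together with a multicharge in $\mathbb Z^n$. Define bijections on pairs (partition, charge) as follows. * $\tau_e(\lambda,m)=(\boldsymbol\lambda_e,\mathbf s_e)$ is the charged $e$-partition with symbol $(Y_0,\dots,Y_{e-1})$, $Y_j=\{k : j+ke\in X^m(\lambda)\}$. * $\tau^l(\lambda,m)=(\boldsymbol\lambda^l,\mathbf s^l)$ is the charged $l$-partition with symbol $(X_0,\dots,X_{l-1})$, $X_{l-1-d}=\{c+ek : c+ed+elk\in X^m(\lambda),\ 0\le c<e,\ k\in\mathbb Z\}$ for $0\le d<l$. **Crystal action.** Let $\boldsymbol\lambda^l=(\lambda^0,\dots,\lambda^{l-1})$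 be an $l$-partition and $\mathbf s^l=(s_0,\dots,s_{l-1})\in\mathbb Z^l$. The content of a node $(a,b,c)$ (row $a$, column $b$, component $c$) is $b-a+s_c$, and it is an $i$-node if its content is $\equiv i$ modulo $e$. Write $\gamma<\gamma'$ if the content of $\gamma$ is smaller than that of $\gamma'$, or if the contents are equal and the component of $\gamma$ is larger than that of $\gamma'$. List the addable ($A$) and removable ($R$) $i$-nodes in increasing order and delete subwords $RA$ as long as possible; a word $A^pR^q$ remains. The operator $\tilde f_i$ adds the node of the rightmost remaining $A$ (and gives $0$ if $p=0$), and $\tilde e_i$ removes the node of the leftmost remaining $R$ (and gives $0$ if $q=0$). The set of Uglov $l$-partitions for $(e,\mathbf s^l)$ is the smallest set that contains the empty $l$-partition and contains $\boldsymbol\lambda^l$ whenever it contains $\tilde e_i\boldsymbol\lambda^l\ne 0$ for some $i\in\{0,\dots,e-1\}$. Put $\varepsilon_i=\max\{k:\tilde f_i^k\boldsymbol\lambda^l\neq0\}$, $\varphi_i=\max\{k:\tilde e_i^k\boldsymbol\lambda^l\ne0\}$, and $$\sigma_i\star\boldsymbol\lambda^l=\tilde e_i^{\,\varphi_i-\varepsilon_i}\boldsymbol\lambda^l\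 \text{ if }\varphi_i\ge\varepsilon_i,\qquad \sigma_i\star\boldsymbol\lambda^l=\tilde f_i^{\,\varepsilon_i-\varphi_i}\boldsymbol\lambda^l\ \text{ if }\varphi_i\le\varepsilon_i .$$ **The bijections $\Psi$.** For $\mathbf s=(s_0,\dots,s_{e-1})\in\mathbb Z^e$ and $1\le i\le e-1$ let $\sigma_i.\mathbf s=\mathbf s.\sigma_i$ be obtained from $\mathbf s$ by exchanging $s_{i-1}$ and $s_i$. The Jacon–Lecouvey bijection $\Psi^{\mathbf s\to\mathbf s.\sigma_i}$ on $e$-partitions only modifies the components $i-1$ and $i$ of the symbol of $(\boldsymbol\lambda,\mathbf s)$. Cut both components on the left at a place below which both contain all integers; finite sets $Y$ (from component $i-1$) and $X$ (from component $i$) remain. * If $|X|\ge|Y|$, let the elements $y$ of $Y$, in increasing order, successively choose the largest not yet chosen $x\in X$ with $x\le y$, or, if there is none, the largest not yet chosen $x\in X$. Let $C\subset X$ be the set of chosen elements. Replace $(Y,X)$ by $\big((X\setminus C)\cup Y,\ C\big)$. * If $|X|<|Y|$, let the elements $x$ of $X$, in increasing order, successively choose the smallest not yet chosen $y\in Y$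 with $y\ge x$, or, if there is none, the smallest not yet chosen $y\in Y$. Let $C\subset Y$ be the set of chosen elements. Replace $(Y,X)$ by $\big(C,\ (Y\setminus C)\cup X\big)$. Put the tail back; $\Psi^{\mathbf s\to\mathbf s.\sigma_i}(\boldsymbol\lambda)$ is the $e$-partition of the resulting $e$-symbol, which has multicharge $\mathbf s.\sigma_i$. For an $e$-partition $\boldsymbol\lambda=(\lambda^0,\dots,\lambda^{e-1})$ and $\mathbf s\in\mathbb Z^e$ put $\boldsymbol\lambda^{\ast}=(\lambda^{e-1},\lambda^0,\dots,\lambda^{e-2})$, $\boldsymbol\lambda^{\triangle}=(\lambda^1,\dots,\lambda^{e-1},\lambda^0)$, $\mathbf s^{\ast}=(s_{e-1}+l,s_0,\dots,s_{e-2})$ and $\sigma_0.\mathbf s=(s_{e-1}+l,s_1,\dots,s_{e-2},s_0-l)$. **Proposition.** Let $\lambda$ be a partition, $m\in\mathbb Z$, $\tau^l(\lambda,m)=(\boldsymbol\lambda^l,\mathbf s^l)$ and $\tau_e(\lambda,m)=(\boldsymbol\lambda_e,\mathbf s_e)$, and assume that $\boldsymbol\lambda^l$ is an Uglov $l$-partition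 for $(e,\mathbf s^l)$. Then $\sigma_i\star\boldsymbol\lambda^l$ is well defined (nonzero) for $0\le i\le e-1$. For $i=1,\dots,e-1$, $$(\tau^l)^{-1}(\sigma_i\star\boldsymbol\lambda^l,\mathbf s^l)=\tau_e^{-1}\big(\Psi^{\mathbf s_e\to\mathbf s_e.\sigma_i}(\boldsymbol\lambda_e),\ \sigma_i.\mathbf s_e\big),$$ and for $i=0$, $$(\tau^l)^{-1}(\sigma_0\star\boldsymbol\lambda^l,\mathbf s^l)=\tau_e^{-1}\Big(\big(\Psi^{\mathbf s_e^{\ast}\to(\mathbf s_e^{\ast}).\sigma_1}(\boldsymbol\lambda_e^{\ast})\big)^{\triangle},\ \sigma_0.\mathbf s_e\Big).$$ Both sides of each equation are pairs (partition, charge) with charge $m$. -/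

import Mathlib

noncomputable section

open scoped Classical

namespace LevelRank

/-! ### Symbols (beta-sets) and their partitions -/

/-- A symbol (beta-set, one-runner abacus), given by the set of its values (the positions of the
black beads): a set of integers that is bounded above and contains all sufficiently small
integers. Its increasing enumeration can be indexed in exactly one way as `(β_i)_{i < m}` with
`β_i = i` for all sufficiently small `i`; this `m` is its charge. -/
def BetaSymbol : Type :=
  {X : Set ℤ // (∃ M : ℤ, ∀ x ∈ X, x < M) ∧ ∃ N : ℤ, ∀ x : ℤ, x < N → x ∈ X}

/-- The values of the symbol of charge `m` of the partition `lam`: with rows indexed from `0`, they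
are `λ_a - (a + 1) + m` for `a = 0, 1, 2, …`. -/
def betaSet (lam : YoungDiagram) (m : ℤ) : Set ℤ :=
  Set.range fun a : ℕ => (lam.rowLen a : ℤ) - (a + 1) + m

theorem rowLen_eq_zero (lam : YoungDiagram) {a : ℕ} (ha : lam.colLen 0 ≤ a) :
    lam.rowLen a = 0 := by
  by_contra h
  have h1 : (a, 0) ∈ lam := YoungDiagram.mem_iff_lt_rowLen.2 (Nat.pos_of_ne_zero h)
  have h2 := YoungDiagram.mem_iff_lt_colLen.1 h1
  omega

/-- The symbol of charge `m` of the partition `lam`. -/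
def toSymbol (p : YoungDiagram × ℤ) : BetaSymbol :=
  ⟨betaSet p.1 p.2, by
    refine ⟨⟨p.1.rowLen 0 + p.2, ?_⟩, ⟨p.2 - p.1.colLen 0, ?_⟩⟩
    · rintro x ⟨a, rfl⟩
      have := p.1.rowLen_anti 0 a (Nat.zero_le a)
      dsimp only
      omega
    · intro x hx
      refine ⟨(p.2 - x - 1).toNat, ?_⟩
      dsimp only
      rw [rowLen_eq_zero p.1 (by omega)]
      omega⟩

theorem betaSet_strictAnti (lam : YoungDiagram) (m : ℤ) :
    StrictAnti fun a : ℕ => (lam.rowLen a : ℤ) - (a + 1) + m := by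
  intro a b hab
  have := lam.rowLen_anti a b hab.le
  change (lam.rowLen b : ℤ) - (b + 1) + m < (lam.rowLen a : ℤ) - (a + 1) + m
  omega

theorem toSymbol_injective : Function.Injective toSymbol := by
  rintro ⟨lam, m⟩ ⟨lam', m'⟩ h
  have h1 : betaSet lam m = betaSet lam' m' := congrArg Subtype.val h
  have h2 : (fun a : ℕ => (lam.rowLen a : ℤ) - (a + 1) + m)
      = fun a : ℕ => (lam'.rowLen a : ℤ) - (a + 1) + m' := by
    have e1 := (betaSet_strictAnti lam m).dual_right
    have e2 := (betaSet_strictAnti lam' m').dual_right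
    exact (StrictMono.range_inj e1 e2).1 h1
  have hm : m = m' := by
    have := congrFun h2 (max (lam.colLen 0) (lam'.colLen 0))
    rw [rowLen_eq_zero lam (le_max_left _ _), rowLen_eq_zero lam' (le_max_right _ _)] at this
    omega
  subst hm
  have hl : lam = lam' := by
    apply SetLike.ext
    rintro ⟨a, b⟩
    have := congrFun h2 a
    rw [YoungDiagram.mem_iff_lt_rowLen, YoungDiagram.mem_iff_lt_rowLen]
    omega
  rw [hl]

/-- A weakly decreasing, eventually zero sequence is the sequence of row lengths of a Young
diagram. -/
theorem exists_rowLen_eq (f : ℕ → ℕ) (hf : Antitone f) (N : ℕ) (hN : f N = 0) :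
    ∃ lam : YoungDiagram, ∀ a, lam.rowLen a = f a := by
  refine ⟨⟨(Finset.range N ×ˢ Finset.range (f 0)).filter fun c => c.2 < f c.1, ?_⟩, ?_⟩
  · rintro ⟨a, b⟩ ⟨a', b'⟩ hle hmem
    have ha : a' ≤ a := hle.1
    have hb : b' ≤ b := hle.2
    have := hf ha
    simp only [Finset.coe_filter, Finset.mem_product, Finset.mem_range, Set.mem_ofPred_eq] at hmem ⊢
    omega
  · intro a
    have key : ∀ lam : YoungDiagram, (∀ b, (a, b) ∈ lam ↔ b < f a) → lam.rowLen a = f a := by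
      intro lam h
      have h1 : ∀ b, b < lam.rowLen a ↔ b < f a := fun b => by
        rw [← YoungDiagram.mem_iff_lt_rowLen, h b]
      have h2 := h1 (f a)
      have h3 := h1 (lam.rowLen a)
      omega
    apply key
    intro b
    change (a, b) ∈ (Finset.range N ×ˢ Finset.range (f 0)).filter (fun c => c.2 < f c.1) ↔ _
    simp only [Finset.mem_filter, Finset.mem_product, Finset.mem_range]
    constructor
    · exact fun h => h.2
    · intro h
      have h0 := hf (Nat.zero_le a)
      refine ⟨⟨?_, by omega⟩, h⟩
      by_contra hc
      have := hf (not_lt.1 hc)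
      omega

theorem toSymbol_surjective : Function.Surjective toSymbol := by
  rintro ⟨X, ⟨M, hM⟩, N, hN⟩
  -- the beads, enumerated from the right
  let P : ℕ → Prop := fun n => M - n ∈ X
  have hP : ∀ n : ℕ, M - N < n → P n := fun n hn => hN _ (by omega)
  have hinf : (Set.ofPred P).Infinite := by
    rw [Set.infinite_iff_exists_gt]
    intro a
    refine ⟨max (a + 1) ((M - N).toNat + 1), hP _ ?_, ?_⟩
    · have := le_max_right (a + 1) ((M - N).toNat + 1)
      omega
    · have := le_max_left (a + 1) ((M - N).toNat + 1)
      omega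
  have hmono := Nat.nth_strictMono hinf
  have hrange := Nat.range_nth_of_infinite hinf
  obtain ⟨A, hA⟩ : ∃ A, Nat.nth P A = (M - N).toNat + 1 := by
    have : (M - N).toNat + 1 ∈ Set.range (Nat.nth P) := by
      rw [hrange]; exact hP _ (by omega)
    exact this
  have hlower : ∀ k a, Nat.nth P a + k ≤ Nat.nth P (a + k) := by
    intro k a
    induction k with
    | zero => simp
    | succ k ih =>
      have := hmono (show a + k < a + (k + 1) by omega)
      omega
  have htail : ∀ k, Nat.nth P (A + k) = Nat.nth P A + k := by
    intro k
    induction k with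
    | zero => simp
    | succ k ih =>
      have hmem : Nat.nth P A + (k + 1) ∈ Set.range (Nat.nth P) := by
        rw [hrange]; exact hP _ (by omega)
      obtain ⟨c, hc⟩ := hmem
      have h1 := hlower (k + 1) A
      have h2 : A + k < c := hmono.lt_iff_lt.1 (by omega)
      have h3 : Nat.nth P (A + (k + 1)) ≤ Nat.nth P c := hmono.monotone (by omega)
      omega
  let m : ℤ := M - Nat.nth P A + A + 1
  let f : ℕ → ℕ := fun a => (M - Nat.nth P a + (a + 1) - m).toNat
  have hf : ∀ a, (f a : ℤ) = M - Nat.nth P a + (a + 1) - m := by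
    intro a
    have : 0 ≤ M - (Nat.nth P a : ℤ) + (a + 1) - m := by
      rcases le_total a A with h | h
      · have := hlower (A - a) a
        rw [show a + (A - a) = A by omega] at this
        simp only [m]; omega
      · have := htail (a - A)
        rw [show A + (a - A) = a by omega] at this
        simp only [m]; omega
    simp only [f]; omega
  have hanti : Antitone f := by
    intro a b hab
    have h1 := hf a
    have h2 := hf b
    have h3 := hlower (b - a) a
    rw [show a + (b - a) = b by omega] at h3
    omega
  have hzero : f A = 0 := by
    have := hf A
    simp only [m] at this
    omega
  obtain ⟨lam, hlam⟩ := exists_rowLen_eq f hanti A hzero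
  refine ⟨(lam, m), Subtype.ext ?_⟩
  change betaSet lam m = X
  ext x
  constructor
  · rintro ⟨a, rfl⟩
    dsimp only
    rw [hlam, hf]
    have : P (Nat.nth P a) := Nat.nth_mem_of_infinite hinf a
    have h2 : M - (Nat.nth P a : ℤ) + (a + 1) - m - (a + 1) + m = M - Nat.nth P a := by ring
    rw [h2]
    exact this
  · intro hx
    have hlt := hM x hx
    have hPx : P (M - x).toNat := by
      change M - ((M - x).toNat : ℤ) ∈ X
      rwa [show M - ((M - x).toNat : ℤ) = x by omega]
    have : (M - x).toNat ∈ Set.range (Nat.nth P) := by rw [hrange]; exact hPx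
    obtain ⟨a, ha⟩ := this
    refine ⟨a, ?_⟩
    dsimp only
    rw [hlam, hf, ha]
    omega

/-- The bijection between pairs (partition, charge) and symbols. -/
def symbolEquiv : YoungDiagram × ℤ ≃ BetaSymbol :=
  Equiv.ofBijective toSymbol ⟨toSymbol_injective, toSymbol_surjective⟩

/-! ### Multipartitions and multisymbols -/

/-- `l`-partitions `(λ^0, …, λ^{l-1})`. -/
abbrev MultiPartition (l : ℕ) : Type := Fin l → YoungDiagram

/-- `l`-multicharges `(s_0, …, s_{l-1})`. -/
abbrev MultiCharge (l : ℕ) : Type := Fin l → ℤ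

/-- The bijection between charged `l`-partitions and `l`-symbols. -/
def multiSymbolEquiv (l : ℕ) : MultiPartition l × MultiCharge l ≃ (Fin l → BetaSymbol) :=
  (Equiv.arrowProdEquivProdArrow (Fin l) (fun _ => YoungDiagram) fun _ => ℤ).symm.trans
    (Equiv.piCongrRight fun _ => symbolEquiv)

/-! ### The `e`-quotient and Uglov's `l`-quotient -/

/-- The residue of an integer modulo `e`, as an element of `{0, …, e - 1}`. -/
def residue (e : ℕ) [NeZero e] (n : ℤ) : Fin e :=
  ⟨(n % e).toNat, by
    have he : (0 : ℤ) < e := by exact_mod_cast Nat.pos_of_ne_zero (NeZero.ne e)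
    have h1 := Int.emod_nonneg n he.ne'
    have h2 := Int.emod_lt_of_pos n he
    omega⟩

theorem residue_val (e : ℕ) [NeZero e] (n : ℤ) : ((residue e n : ℕ) : ℤ) = n % e := by
  have he : (0 : ℤ) < e := by exact_mod_cast Nat.pos_of_ne_zero (NeZero.ne e)
  exact Int.toNat_of_nonneg (Int.emod_nonneg n he.ne')

theorem residue_eq (e : ℕ) [NeZero e] (j : Fin e) (k : ℤ) : residue e (j + k * e) = j := by
  apply Fin.ext
  have h := residue_val e (j + k * e)
  rw [Int.add_mul_emod_self_right, Int.emod_eq_of_lt (by omega) (by have := j.2; omega)] at h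
  exact_mod_cast h

theorem ediv_eq (e : ℕ) [NeZero e] (j : Fin e) (k : ℤ) : ((j : ℤ) + k * e) / e = k := by
  have he : (e : ℤ) ≠ 0 := by exact_mod_cast NeZero.ne e
  rw [Int.add_mul_ediv_right _ _ he, Int.ediv_eq_zero_of_lt (by omega) (by have := j.2; omega)]
  ring

theorem residue_add_ediv (e : ℕ) [NeZero e] (n : ℤ) :
    ((residue e n : ℕ) : ℤ) + n / e * e = n := by
  rw [residue_val, mul_comm]
  exact Int.emod_add_mul_ediv n e

/-- The values of finitely many symbols have a common upper bound. -/
theorem exists_upper (e : ℕ) (Y : Fin e → BetaSymbol) :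
    ∃ M : ℤ, 0 ≤ M ∧ ∀ j, ∀ x ∈ (Y j).1, x < M := by
  choose M hM using fun j => (Y j).2.1
  refine ⟨∑ j, |M j|, Finset.sum_nonneg fun j _ => abs_nonneg _, fun j x hx => ?_⟩
  have h1 := Finset.single_le_sum (f := fun j => |M j|) (fun j _ => abs_nonneg _)
    (Finset.mem_univ j)
  have h2 := le_abs_self (M j)
  have h3 := hM j x hx
  omega

/-- Finitely many symbols contain all integers below a common bound. -/
theorem exists_lower (e : ℕ) (Y : Fin e → BetaSymbol) :
    ∃ N : ℤ, N ≤ 0 ∧ ∀ j, ∀ x : ℤ, x < N → x ∈ (Y j).1 := by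
  choose N hN using fun j => (Y j).2.2
  refine ⟨-∑ j, |N j|, neg_nonpos.2 (Finset.sum_nonneg fun j _ => abs_nonneg _), fun j x hx => ?_⟩
  have h1 := Finset.single_le_sum (f := fun j => |N j|) (fun j _ => abs_nonneg _)
    (Finset.mem_univ j)
  have h2 := neg_abs_le (N j)
  refine hN j x ?_
  omega

theorem isSymbol_merge (e : ℕ) [NeZero e] (Y : Fin e → BetaSymbol) :
    (∃ M : ℤ, ∀ x ∈ {n : ℤ | n / e ∈ (Y (residue e n)).1}, x < M) ∧
      ∃ N : ℤ, ∀ x : ℤ, x < N → x ∈ {n : ℤ | n / e ∈ (Y (residue e n)).1} := by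
  have he : (0 : ℤ) < e := by exact_mod_cast Nat.pos_of_ne_zero (NeZero.ne e)
  obtain ⟨M, -, hM⟩ := exists_upper e Y
  obtain ⟨N, -, hN⟩ := exists_lower e Y
  refine ⟨⟨M * e, fun n hn => ?_⟩, ⟨N * e, fun n hn => ?_⟩⟩
  · exact (Int.ediv_lt_iff_lt_mul he).1 (hM _ _ hn)
  · exact hN _ _ ((Int.ediv_lt_iff_lt_mul he).2 hn)

theorem isSymbol_runner (e : ℕ) [NeZero e] (X : BetaSymbol) (j : Fin e) :
    (∃ M : ℤ, ∀ x ∈ {k : ℤ | (j : ℤ) + k * e ∈ X.1}, x < M) ∧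
      ∃ N : ℤ, ∀ x : ℤ, x < N → x ∈ {k : ℤ | (j : ℤ) + k * e ∈ X.1} := by
  have he : (0 : ℤ) < e := by exact_mod_cast Nat.pos_of_ne_zero (NeZero.ne e)
  obtain ⟨M, hM0, hM⟩ := exists_upper 1 fun _ => X
  obtain ⟨N, hN0, hN⟩ := exists_lower 1 fun _ => X
  have hj := j.2
  refine ⟨⟨M, fun k hk => ?_⟩, ⟨N, fun k hk => ?_⟩⟩
  · have h1 := hM 0 _ hk
    by_contra h
    have : M * 1 ≤ k * e := mul_le_mul (not_lt.1 h) (by omega) (by omega) (by omega)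
    omega
  · apply hN 0
    have h2 : (k + 1) * (e : ℤ) ≤ N * 1 := by nlinarith
    nlinarith

/-- Splitting a symbol into `e` runners: the `j`-th runner is `{k | j + k e ∈ X}`. -/
def splitEquiv (e : ℕ) [NeZero e] : BetaSymbol ≃ (Fin e → BetaSymbol) where
  toFun X j := ⟨{k : ℤ | (j : ℤ) + k * e ∈ X.1}, isSymbol_runner e X j⟩
  invFun Y := ⟨{n : ℤ | n / e ∈ (Y (residue e n)).1}, isSymbol_merge e Y⟩
  left_inv X := by
    apply Subtype.ext
    ext n
    simp only [Set.mem_ofPred_eq, residue_add_ediv]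
  right_inv Y := by
    funext j
    apply Subtype.ext
    ext k
    simp only [Set.mem_ofPred_eq, residue_eq, ediv_eq]

/-- `τ_e`: a charged partition `(λ, m)` is sent to its `e`-quotient and its `e`-core multicharge.
The `j`-th component of the associated `e`-symbol is `{k | j + k e ∈ X^m(λ)}`. -/
def tauE (e : ℕ) [NeZero e] : YoungDiagram × ℤ ≃ MultiPartition e × MultiCharge e :=
  symbolEquiv.trans ((splitEquiv e).trans (multiSymbolEquiv e).symm)

theorem isSymbol_uglov (e l : ℕ) [NeZero e] [NeZero l] (X : BetaSymbol) (r : Fin l) :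
    (∃ M : ℤ, ∀ x ∈ {x : ℤ | x % e + e * (r.rev : ℕ) + e * l * (x / e) ∈ X.1}, x < M) ∧
      ∃ N : ℤ, ∀ x : ℤ, x < N → x ∈ {x : ℤ | x % e + e * (r.rev : ℕ) + e * l * (x / e) ∈ X.1} := by
  have he : (0 : ℤ) < e := by exact_mod_cast Nat.pos_of_ne_zero (NeZero.ne e)
  have hl : (0 : ℤ) < l := by exact_mod_cast Nat.pos_of_ne_zero (NeZero.ne l)
  obtain ⟨M, hM0, hM⟩ := exists_upper 1 fun _ => X
  obtain ⟨N, hN0, hN⟩ := exists_lower 1 fun _ => X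
  have hr : ((r.rev : ℕ) : ℤ) + 1 ≤ l := by have := r.rev.2; omega
  have hel : (1 : ℤ) ≤ e * l := by nlinarith
  have her : (0 : ℤ) ≤ e * (r.rev : ℕ) := by positivity
  refine ⟨⟨M * e, fun x hx => ?_⟩, ⟨N * e, fun x hx => ?_⟩⟩
  · have h1 := hM 0 _ hx
    have h2 := Int.emod_nonneg x he.ne'
    rw [← Int.ediv_lt_iff_lt_mul he]
    by_contra h
    have : 1 * M ≤ e * l * (x / e) := mul_le_mul hel (not_lt.1 h) hM0 (by omega)
    omega
  · apply hN 0
    have h2 := Int.emod_lt_of_pos x he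
    have h3 : x / e < N := (Int.ediv_lt_iff_lt_mul he).2 hx
    have h4 : (e : ℤ) * (r.rev : ℕ) + e ≤ e * l := by nlinarith
    have h5 : (e : ℤ) * l * (x / e + 1) ≤ 1 * N := by nlinarith
    nlinarith

theorem isSymbol_uglov_merge (e l : ℕ) [NeZero e] [NeZero l] (Y : Fin l → BetaSymbol) :
    (∃ M : ℤ, ∀ x ∈ {n : ℤ | n % e + e * (n / e / l) ∈ (Y (residue l (n / e)).rev).1}, x < M) ∧
      ∃ N : ℤ, ∀ x : ℤ, x < N →
        x ∈ {n : ℤ | n % e + e * (n / e / l) ∈ (Y (residue l (n / e)).rev).1} := by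
  have he : (0 : ℤ) < e := by exact_mod_cast Nat.pos_of_ne_zero (NeZero.ne e)
  have hl : (0 : ℤ) < l := by exact_mod_cast Nat.pos_of_ne_zero (NeZero.ne l)
  obtain ⟨M, hM0, hM⟩ := exists_upper l Y
  obtain ⟨N, hN0, hN⟩ := exists_lower l Y
  refine ⟨⟨M * l * e, fun n hn => ?_⟩, ⟨N * l * e, fun n hn => ?_⟩⟩
  · have h1 := hM _ _ hn
    have h2 := Int.emod_nonneg n he.ne'
    rw [← Int.ediv_lt_iff_lt_mul he, ← Int.ediv_lt_iff_lt_mul hl]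
    by_contra h
    nlinarith
  · apply hN
    have h2 := Int.emod_lt_of_pos n he
    have h3 : n / e / l < N :=
      (Int.ediv_lt_iff_lt_mul hl).2 ((Int.ediv_lt_iff_lt_mul he).2 hn)
    nlinarith

/-- Splitting a symbol into Uglov's `l`-symbol. Every integer is uniquely `c + e d + e l k` with
`0 ≤ c < e` and `0 ≤ d < l`; such an element of `X` contributes the bead `c + e k` to the runner
`l - 1 - d`. -/
def uglovSplitEquiv (e l : ℕ) [NeZero e] [NeZero l] : BetaSymbol ≃ (Fin l → BetaSymbol) where
  toFun X r := ⟨{x : ℤ | x % e + e * (r.rev : ℕ) + e * l * (x / e) ∈ X.1}, isSymbol_uglov e l X r⟩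
  invFun Y := ⟨{n : ℤ | n % e + e * (n / e / l) ∈ (Y (residue l (n / e)).rev).1},
    isSymbol_uglov_merge e l Y⟩
  left_inv X := by
    have he : (0 : ℤ) < e := by exact_mod_cast Nat.pos_of_ne_zero (NeZero.ne e)
    apply Subtype.ext
    ext n
    have h1 := Int.emod_nonneg n he.ne'
    have h2 := Int.emod_lt_of_pos n he
    have h3 : (n % e + e * (n / e / l)) % e = n % e := by
      rw [Int.add_mul_emod_self_left, Int.emod_emod]
    have h4 : (n % e + e * (n / e / l)) / e = n / e / l := by
      rw [Int.add_mul_ediv_left _ _ he.ne', Int.ediv_eq_zero_of_lt h1 h2, zero_add]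
    have h5 : n % e + e * ((residue l (n / e) : ℕ) : ℤ) + e * l * (n / e / l) = n := by
      have h6 := residue_add_ediv l (n / e)
      have h7 := Int.emod_add_mul_ediv n e
      calc _ = n % e + e * (((residue l (n / e) : ℕ) : ℤ) + n / e / l * l) := by ring
        _ = n := by rw [h6, h7]
    simp only [Set.mem_ofPred_eq, h3, h4, Fin.rev_rev, h5]
  right_inv Y := by
    have he : (0 : ℤ) < e := by exact_mod_cast Nat.pos_of_ne_zero (NeZero.ne e)
    funext r
    apply Subtype.ext
    ext x
    have h1 := Int.emod_nonneg x he.ne'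
    have h2 := Int.emod_lt_of_pos x he
    have h0 : x % e + e * ((r.rev : ℕ) : ℤ) + e * l * (x / e)
        = x % e + e * (((r.rev : ℕ) : ℤ) + x / e * l) := by ring
    have h3 : (x % e + e * ((r.rev : ℕ) : ℤ) + e * l * (x / e)) % e = x % e := by
      rw [h0, Int.add_mul_emod_self_left, Int.emod_emod]
    have h4 : (x % e + e * ((r.rev : ℕ) : ℤ) + e * l * (x / e)) / e
        = ((r.rev : ℕ) : ℤ) + x / e * l := by
      rw [h0, Int.add_mul_ediv_left _ _ he.ne', Int.ediv_eq_zero_of_lt h1 h2, zero_add]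
    simp only [Set.mem_ofPred_eq, h3, h4, residue_eq, ediv_eq, Fin.rev_rev, Int.emod_add_mul_ediv]

/-- `τ^l`: a charged partition `(λ, m)` is sent to its Uglov `l`-partition and `l`-multicharge. -/
def tauL (e l : ℕ) [NeZero e] [NeZero l] :
    YoungDiagram × ℤ ≃ MultiPartition l × MultiCharge l :=
  symbolEquiv.trans ((uglovSplitEquiv e l).trans (multiSymbolEquiv l).symm)

/-! ### Nodes, signatures and crystal operators -/

/-- Positions `(a, b, c)` (row, column, component) in Young diagrams of `l`-partitions. Rows and
columns are numbered from `0`. -/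
abbrev Node (l : ℕ) : Type := ℕ × ℕ × Fin l

/-- The Young diagram of an `l`-partition. -/
def nodes {l : ℕ} (lam : MultiPartition l) : Set (Node l) :=
  {γ | (γ.1, γ.2.1) ∈ lam γ.2.2}

/-- The content `b - a + s_c` of a node; its residue is the class of this integer modulo `e`. -/
def content {l : ℕ} (s : MultiCharge l) (γ : Node l) : ℤ :=
  (γ.2.1 : ℤ) - γ.1 + s γ.2.2

def IsAddable {l : ℕ} (lam : MultiPartition l) (γ : Node l) : Prop :=
  γ ∉ nodes lam ∧ ∃ mu : MultiPartition l, nodes mu = insert γ (nodes lam)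

def IsRemovable {l : ℕ} (lam : MultiPartition l) (γ : Node l) : Prop :=
  γ ∈ nodes lam ∧ ∃ mu : MultiPartition l, nodes mu = nodes lam \ {γ}

theorem finite_nodes {l : ℕ} (lam : MultiPartition l) : (nodes lam).Finite := by
  have : nodes lam ⊆ ⋃ c : Fin l, (fun p : ℕ × ℕ => (p.1, p.2, c)) '' (lam c).cells := by
    rintro ⟨a, b, c⟩ h
    exact Set.mem_iUnion.2 ⟨c, (a, b), h, rfl⟩
  exact (Set.finite_iUnion fun c => (lam c).cells.finite_toSet.image _).subset this

theorem finite_addable_removable {l : ℕ} (e : ℕ) (s : MultiCharge l) (i : ℕ)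
    (lam : MultiPartition l) :
    {γ : Node l | (IsAddable lam γ ∨ IsRemovable lam γ) ∧ content s γ ≡ i [ZMOD e]}.Finite := by
  have hsub : {γ : Node l | (IsAddable lam γ ∨ IsRemovable lam γ) ∧ content s γ ≡ i [ZMOD e]} ⊆
      nodes lam ∪ ⋃ c : Fin l, (fun p : ℕ × ℕ => (p.1, p.2, c)) ''
        (Finset.range ((lam c).colLen 0 + 1) ×ˢ Finset.range ((lam c).rowLen 0 + 1) :
          Finset (ℕ × ℕ)) := by
    rintro ⟨a, b, c⟩ ⟨h | h, -⟩
    · right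
      refine Set.mem_iUnion.2 ⟨c, (a, b), ?_, rfl⟩
      obtain ⟨-, mu, hmu⟩ := h
      have hmem : (a, b) ∈ mu c := by
        have : (a, b, c) ∈ nodes mu := by rw [hmu]; exact Set.mem_insert _ _
        exact this
      have hold : ∀ a' b', (a', b') ∈ mu c → (a', b') ≠ (a, b) → (a', b') ∈ lam c := by
        intro a' b' h1 h2
        have h3 : (a', b', c) ∈ nodes mu := h1
        rw [hmu] at h3
        rcases h3 with h3 | h3
        · exact absurd (by simpa using h3) h2
        · exact h3
      simp only [Finset.coe_product, Finset.coe_range, Set.mem_prod, Set.mem_Iio]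
      constructor
      · rcases Nat.eq_zero_or_pos a with h0 | h0
        · omega
        · have h1 := hold (a - 1) b (mu c |>.up_left_mem (by omega) le_rfl hmem)
            (by simp; omega)
          have h2 := (lam c).up_left_mem le_rfl (Nat.zero_le b) h1
          have := YoungDiagram.mem_iff_lt_colLen.1 h2
          omega
      · rcases Nat.eq_zero_or_pos b with h0 | h0
        · omega
        · have h1 := hold a (b - 1) (mu c |>.up_left_mem le_rfl (by omega) hmem)
            (by simp; omega)
          have h2 := (lam c).up_left_mem (Nat.zero_le a) le_rfl h1
          have := YoungDiagram.mem_iff_lt_rowLen.1 h2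
          omega
    · left; exact h.1
  exact ((finite_nodes lam).union
    (Set.finite_iUnion fun c => (Finset.finite_toSet _).image _)).subset hsub

/-- The weak form of the order on nodes: `γ` strictly precedes `γ'` if its content is smaller, or
if the contents are equal and its component is larger. -/
def NodeLE {l : ℕ} (s : MultiCharge l) (γ γ' : Node l) : Prop :=
  content s γ < content s γ' ∨ (content s γ = content s γ' ∧ γ'.2.2 ≤ γ.2.2)

/-- The `i`-signature: the list of the addable and removable `i`-nodes in increasing order. (Two
different addable or removable nodes are never equivalent for `NodeLE`.) -/
def signature {l : ℕ} (e : ℕ) (s : MultiCharge l) (i : ℕ) (lam : MultiPartition l) :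
    List (Node l) :=
  (finite_addable_removable e s i lam).toFinset.toList.mergeSort
    fun γ γ' => decide (NodeLE s γ γ')

/-- Deletes from a word of addable (`A`) and removable (`R`) nodes subwords `RA` as long as
possible. -/
def cancelRA {l : ℕ} (lam : MultiPartition l) : List (Node l) → List (Node l)
  | [] => []
  | γ :: w =>
    match cancelRA lam w with
    | [] => [γ]
    | γ' :: w' => if IsRemovable lam γ ∧ IsAddable lam γ' then w' else γ :: γ' :: w'

/-- The reduced `i`-signature, of the form `A^p R^q`. -/
def reducedSignature {l : ℕ} (e : ℕ) (s : MultiCharge l) (i : ℕ) (lam : MultiPartition l) :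
    List (Node l) :=
  cancelRA lam (signature e s i lam)

/-- The good addable `i`-node: the rightmost addable node of the reduced signature, if any. -/
def goodAddable {l : ℕ} (e : ℕ) (s : MultiCharge l) (i : ℕ) (lam : MultiPartition l) :
    Option (Node l) :=
  ((reducedSignature e s i lam).filter fun γ => decide (IsAddable lam γ)).getLast?

/-- The good removable `i`-node: the leftmost removable node of the reduced signature, if any. -/
def goodRemovable {l : ℕ} (e : ℕ) (s : MultiCharge l) (i : ℕ) (lam : MultiPartition l) :
    Option (Node l) :=
  ((reducedSignature e s i lam).filter fun γ => decide (IsRemovable lam γ)).head?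

/-- The `l`-partition with a given set of nodes, if there is one (it is then unique). -/
def ofNodes {l : ℕ} (S : Set (Node l)) : Option (MultiPartition l) :=
  if h : ∃ mu : MultiPartition l, nodes mu = S then some h.choose else none

/-- The crystal operator `f̃_i`: adding the good addable `i`-node; `none` stands for `0`. -/
def fTilde {l : ℕ} (e : ℕ) (s : MultiCharge l) (i : ℕ) (lam : MultiPartition l) :
    Option (MultiPartition l) :=
  (goodAddable e s i lam).bind fun γ => ofNodes (insert γ (nodes lam))

/-- The crystal operator `ẽ_i`: removing the good removable `i`-node; `none` stands for `0`. -/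
def eTilde {l : ℕ} (e : ℕ) (s : MultiCharge l) (i : ℕ) (lam : MultiPartition l) :
    Option (MultiPartition l) :=
  (goodRemovable e s i lam).bind fun γ => ofNodes (nodes lam \ {γ})

/-- `f̃_i^k λ`. -/
def fTildePow {l : ℕ} (e : ℕ) (s : MultiCharge l) (i k : ℕ) (lam : MultiPartition l) :
    Option (MultiPartition l) :=
  (fun o : Option (MultiPartition l) => o.bind (fTilde e s i))^[k] (some lam)

/-- `ẽ_i^k λ`. -/
def eTildePow {l : ℕ} (e : ℕ) (s : MultiCharge l) (i k : ℕ) (lam : MultiPartition l) :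
    Option (MultiPartition l) :=
  (fun o : Option (MultiPartition l) => o.bind (eTilde e s i))^[k] (some lam)

/-- `ε_i(λ) = max {k | f̃_i^k λ ≠ 0}`. -/
def epsilon {l : ℕ} (e : ℕ) (s : MultiCharge l) (i : ℕ) (lam : MultiPartition l) : ℕ :=
  sSup {k : ℕ | fTildePow e s i k lam ≠ none}

/-- `φ_i(λ) = max {k | ẽ_i^k λ ≠ 0}`. -/
def phi {l : ℕ} (e : ℕ) (s : MultiCharge l) (i : ℕ) (lam : MultiPartition l) : ℕ :=
  sSup {k : ℕ | eTildePow e s i k lam ≠ none}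

/-- The crystal action `σ_i ⋆ λ`. -/
def sigmaStar {l : ℕ} (e : ℕ) (s : MultiCharge l) (i : ℕ) (lam : MultiPartition l) :
    Option (MultiPartition l) :=
  if epsilon e s i lam ≤ phi e s i lam then
    eTildePow e s i (phi e s i lam - epsilon e s i lam) lam
  else
    fTildePow e s i (epsilon e s i lam - phi e s i lam) lam

/-- The Uglov `l`-partitions for `e` and the multicharge `s`. -/
inductive IsUglov {l : ℕ} (e : ℕ) (s : MultiCharge l) : MultiPartition l → Prop
  | empty : IsUglov e s fun _ => ⊥
  | step {lam mu : MultiPartition l} (i : ℕ) (hi : i < e) (h : eTilde e s i lam = some mu)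
      (hmu : IsUglov e s mu) : IsUglov e s lam

/-! ### The bijections `Ψ` for simple transpositions -/

theorem exists_tail (X Y : BetaSymbol) : ∃ N : ℤ, ∀ x : ℤ, x < N → x ∈ X.1 ∧ x ∈ Y.1 := by
  obtain ⟨N, hN⟩ := X.2.2
  obtain ⟨N', hN'⟩ := Y.2.2
  exact ⟨min N N', fun x hx => ⟨hN x (lt_of_lt_of_le hx (min_le_left _ _)),
    hN' x (lt_of_lt_of_le hx (min_le_right _ _))⟩⟩

/-- An integer below which all positions are black in both symbols. -/
def tailBound (X Y : BetaSymbol) : ℤ := (exists_tail X Y).choose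

theorem finite_beads (X : BetaSymbol) (N : ℤ) : {x : ℤ | x ∈ X.1 ∧ N ≤ x}.Finite := by
  obtain ⟨M, hM⟩ := X.2.1
  exact (Set.finite_Ico N M).subset fun x hx => ⟨hx.2, hM x hx.1⟩

/-- The finite set of elements of a symbol that are at least `N`. -/
def beads (X : BetaSymbol) (N : ℤ) : Finset ℤ := (finite_beads X N).toFinset

/-- The symbol consisting of all integers below `N` and of the elements of `F`. -/
def ofBeads (N : ℤ) (F : Finset ℤ) : BetaSymbol :=
  ⟨{x : ℤ | x < N ∨ x ∈ F}, by
    obtain ⟨M, hM⟩ := F.bddAbove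
    refine ⟨⟨max N (M + 1), ?_⟩, ⟨N, fun x hx => Or.inl hx⟩⟩
    rintro x (hx | hx)
    · exact lt_of_lt_of_le hx (le_max_left _ _)
    · have := hM hx
      exact lt_of_lt_of_le (by omega) (le_max_right _ _)⟩

/-- Successively, each `y` in the list chooses the largest not yet chosen element `x ≤ y` of `X`,
and the largest not yet chosen element of `X` if there is no such `x`. The result is the set of
chosen elements. -/
def chooseBelow : List ℤ → Finset ℤ → Finset ℤ
  | [], _ => ∅
  | y :: ys, X =>
    if h : (X.filter fun x => x ≤ y).Nonempty then
      insert ((X.filter fun x => x ≤ y).max' h)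
        (chooseBelow ys (X.erase ((X.filter fun x => x ≤ y).max' h)))
    else if h' : X.Nonempty then insert (X.max' h') (chooseBelow ys (X.erase (X.max' h')))
    else ∅

/-- Successively, each `x` in the list chooses the smallest not yet chosen element `y ≥ x` of `Y`,
and the smallest not yet chosen element of `Y` if there is no such `y`. The result is the set of
chosen elements. -/
def chooseAbove : List ℤ → Finset ℤ → Finset ℤ
  | [], _ => ∅
  | x :: xs, Y =>
    if h : (Y.filter fun y => x ≤ y).Nonempty then
      insert ((Y.filter fun y => x ≤ y).min' h)
        (chooseAbove xs (Y.erase ((Y.filter fun y => x ≤ y).min' h)))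
    else if h' : Y.Nonempty then insert (Y.min' h') (chooseAbove xs (Y.erase (Y.min' h')))
    else ∅

/-- The exchange algorithm on a pair `(Y, X)` of finite sets of integers (`Y` from the lower runner,
`X` from the upper runner): the new lower set has the cardinality of `X`, the new upper set that
of `Y`. -/
def exchangeFinset (Y X : Finset ℤ) : Finset ℤ × Finset ℤ :=
  if Y.card ≤ X.card then
    ((X \ chooseBelow (Y.sort (· ≤ ·)) X) ∪ Y, chooseBelow (Y.sort (· ≤ ·)) X)
  else
    (chooseAbove (X.sort (· ≤ ·)) Y, (Y \ chooseAbove (X.sort (· ≤ ·)) Y) ∪ X)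

/-- The exchange algorithm on a pair of symbols, truncated on the left where both are full. -/
def exchange (Y X : BetaSymbol) : BetaSymbol × BetaSymbol :=
  (ofBeads (tailBound Y X)
      (exchangeFinset (beads Y (tailBound Y X)) (beads X (tailBound Y X))).1,
    ofBeads (tailBound Y X)
      (exchangeFinset (beads Y (tailBound Y X)) (beads X (tailBound Y X))).2)

/-- The Jacon-Lecouvey bijection `Ψ^{s → s.σ_i}` on `e`-partitions, for `1 ≤ i ≤ e - 1`: the
exchange algorithm is applied to the components `i - 1` and `i` of the symbol. -/
def psi {e : ℕ} (i : ℕ) (hi : 1 ≤ i) (hie : i < e) (s : MultiCharge e)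
    (lam : MultiPartition e) : MultiPartition e :=
  let X : Fin e → BetaSymbol := multiSymbolEquiv e (lam, s)
  let p : Fin e := ⟨i - 1, by omega⟩
  let q : Fin e := ⟨i, hie⟩
  ((multiSymbolEquiv e).symm
    (Function.update (Function.update X p (exchange (X p) (X q)).1) q (exchange (X p) (X q)).2)).1

/-! ### Actions on multicharges and cyclic twists -/

/-- `σ_i.s` for `1 ≤ i ≤ e - 1`: exchange of `s_{i-1}` and `s_i`. -/
def sigmaCharge {e : ℕ} (i : ℕ) (hi : 1 ≤ i) (hie : i < e) (s : MultiCharge e) : MultiCharge e :=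
  fun j => s (Equiv.swap (⟨i - 1, by omega⟩ : Fin e) ⟨i, hie⟩ j)

/-- `σ_0.s = (s_{e-1} + l, s_1, …, s_{e-2}, s_0 - l)`. -/
def sigmaZeroCharge {e : ℕ} [NeZero e] (l : ℕ) (s : MultiCharge e) : MultiCharge e :=
  fun j => if j = 0 then s (-1) + l else if j = -1 then s 0 - l else s j

/-- `λ^∗ = (λ^{e-1}, λ^0, …, λ^{e-2})`. -/
def twistStar {e : ℕ} [NeZero e] (lam : MultiPartition e) : MultiPartition e :=
  fun j => lam (j - 1)

/-- `λ^△ = (λ^1, …, λ^{e-1}, λ^0)`. -/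
def twistTriangle {e : ℕ} [NeZero e] (lam : MultiPartition e) : MultiPartition e :=
  fun j => lam (j + 1)

/-- `s^∗ = (s_{e-1} + l, s_0, …, s_{e-2})`. -/
def chargeStar {e : ℕ} [NeZero e] (l : ℕ) (s : MultiCharge e) : MultiCharge e :=
  fun j => if j = 0 then s (-1) + l else s (j - 1)

end LevelRank

end

noncomputable section

open scoped Classical

namespace LevelRank

/-! ### Cancellation in words -/

/-! Both sides are operations on two runners of one abacus, the symbol `B` of `(lam, m)`, and they
turn out to be the same operation.

In `B`, the position `x = i + e k` of component `c` of Uglov's symbol sits on runner `i` of the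
`e`-quotient, at height `p = c.rev + l k`. Adding an `i`-node of content `x` moves a bead from `x -
1` to `x`. For `i ≥ 1` this is a horizontal move from runner `i - 1` to runner `i` at height `p`.
For `i = 0` the bead comes from runner `e - 1` at height `p - l`, and becomes horizontal once that
runner is raised by `l`; the twist by `∗` does exactly this. Write `Y` for the (raised) lower runner
and `X` for the upper one. A height carries an addable node if only `Y` has a bead there, and a
removable node if only `X` has one. The order on nodes is the order of heights. So the `i`-signature
is a word on the symmetric difference of `X` and `Y` (`mem_map_signature`, `signature_pairwise`).

Crystal side: let the reduced word be `A^k R^q`. Each application of `f̃_i` or `ẽ_i` changes the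
letter at the border between the two blocks and leaves the positions of the reduced word unchanged
(`IsConfig.move`, `IsConfig.unmove`, `IsConfig.word`). Hence `ε_i = k`, `φ_i = q`, and the action of
`σ_i` rewrites `A^k R^q` as `A^q R^k` on the same positions (`IsConfig.sigmaStar_eq`).

Exchange side: the set left over by the greedy choices does not depend on the order in which the
elements choose (`erasePick_right_comm`). Thus common elements of `X` and `Y` may be paired first,
then every adjacent pair `RA`, since its two letters choose each other (`invariant_cancel`). What
remains is `A^k R^q`, where no admissible choice exists and the fallback rule applies throughout: an
extreme segment of the larger block is chosen, and the rest changes runner. The outcome is again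
`A^q R^k` (`mem_exchange`).

Comparing the two sides gives `sigmaStar_eq_exchange`. The rest is bookkeeping of quotients and
charges; charges are preserved because single bead moves preserve them, and `exchange` swaps those
of its two runners. -/

/-- Deletes subwords `RA` as long as possible, where `R` is a predicate and `A` its negation. -/
def cancel {α : Type*} (R : α → Prop) : List α → List α
  | [] => []
  | γ :: w =>
    match cancel R w with
    | [] => [γ]
    | γ' :: w' => if R γ ∧ ¬ R γ' then w' else γ :: γ' :: w'

/-- A new first letter can cancel only with the first letter of the already reduced tail. The second
alternative also records why the word stays reduced. -/
theorem cancel_cons_cases {α : Type*} (R : α → Prop) (γ : α) (w : List α) :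
    (∃ a L, cancel R w = a :: L ∧ R γ ∧ ¬ R a ∧ cancel R (γ :: w) = L) ∨
      (cancel R (γ :: w) = γ :: cancel R w ∧ ∀ a L, cancel R w = a :: L → R γ → R a) := by
  rcases h : cancel R w with _ | ⟨a, L⟩
  · right; simp [cancel, h]
  · by_cases hc : R γ ∧ ¬ R a
    · left; exact ⟨a, L, rfl, hc.1, hc.2, by simp [cancel, h, hc.1, hc.2]⟩
    · right
      refine ⟨by simp only [cancel, h, if_neg hc], ?_⟩
      intro a' L' e
      obtain ⟨rfl, rfl⟩ := List.cons.inj e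
      tauto

theorem cancel_sublist {α : Type*} (R : α → Prop) (w : List α) :
    (cancel R w).Sublist w := by
  induction w with
  | nil => simp [cancel]
  | cons γ w ih =>
    rcases cancel_cons_cases R γ w with ⟨a, L, h1, -, -, h2⟩ | ⟨h, -⟩
    · rw [h2]
      rw [h1] at ih
      exact ((List.sublist_cons_self a L).trans ih).trans (List.sublist_cons_self _ _)
    · rw [h]; exact ih.cons_cons γ

/-- Once no adjacent `RA` is left, `R` propagates to the right; this is the shape `A^p R^q`. -/
theorem cancel_pairwise {α : Type*} (R : α → Prop) (w : List α) :
    (cancel R w).Pairwise fun a b => R a → R b := by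
  induction w with
  | nil => simp [cancel]
  | cons γ w ih =>
    rcases cancel_cons_cases R γ w with ⟨a, L, h1, -, -, h2⟩ | ⟨h, h'⟩
    · rw [h1] at ih
      rw [h2]; exact ih.of_cons
    · rw [h, List.pairwise_cons]
      refine ⟨fun b hb hγ => ?_, ih⟩
      rcases hL : cancel R w with _ | ⟨a, L⟩
      · simp [hL] at hb
      · have ha := h' a L hL hγ
        rw [hL] at hb ih
        rcases List.mem_cons.1 hb with rfl | hb
        · exact ha
        · exact (List.pairwise_cons.1 ih).1 b hb ha

/-- The reduced word is unchanged, as a list of letters, when the types of its letters are changed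
in such a way that it stays reduced. -/
theorem cancel_eq_of_agree {α : Type*} (R R' : α → Prop) (w : List α) (hw : w.Nodup)
    (hagree : ∀ a ∈ w, a ∉ cancel R w → (R' a ↔ R a))
    (hpair : (cancel R w).Pairwise fun a b => R' a → R' b) :
    cancel R' w = cancel R w := by
  induction w with
  | nil => simp [cancel]
  | cons γ w ih =>
    obtain ⟨hγ, hw⟩ := List.nodup_cons.1 hw
    have hsub := cancel_sublist R w
    rcases cancel_cons_cases R γ w with ⟨a, L, h1, hR, hRa, h2⟩ | ⟨h, h'⟩
    · have hnd : (a :: L).Nodup := by rw [← h1]; exact hw.sublist hsub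
      have haL := (List.nodup_cons.1 hnd).1
      have haw : a ∈ w := hsub.subset (by rw [h1]; simp)
      have hγL : γ ∉ L := fun hm => hγ (hsub.subset (by rw [h1]; simp [hm]))
      rw [h2] at hagree hpair
      have hR'a : ¬ R' a := fun h => hRa ((hagree a (by simp [haw]) haL).1 h)
      have hR'γ : R' γ := (hagree γ (by simp) hγL).2 hR
      -- The reduced tail is `a :: L` and `a` is an `A` for `R'` as well, so putting it in front of
      -- `L` adds no condition.
      have key := ih hw (fun b hb hbn => hagree b (by simp [hb])
        fun hm => hbn (by rw [h1]; simp [hm])) (by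
          rw [h1, List.pairwise_cons]; exact ⟨fun b _ hc => absurd hc hR'a, hpair⟩)
      rw [h1] at key
      rw [h2]
      simp [cancel, key, hR'γ, hR'a]
    · rw [h] at hagree hpair ⊢
      rw [List.pairwise_cons] at hpair
      have key := ih hw (fun b hb hbn => hagree b (by simp [hb]) fun hm => by
        rcases List.mem_cons.1 hm with rfl | hm
        · exact hγ hb
        · exact hbn hm) hpair.2
      rcases cancel_cons_cases R' γ w with ⟨a, L, h1, hR, hRa, h2⟩ | ⟨h3, -⟩
      · exact absurd (hpair.1 a (by rw [← key, h1]; simp) hR) hRa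
      · rw [h3, key]

theorem cancel_map {α β : Type*} (g : α → β) (R : α → Prop) (R' : β → Prop) (w : List α)
    (h : ∀ a ∈ w, R a ↔ R' (g a)) : (cancel R w).map g = cancel R' (w.map g) := by
  induction w with
  | nil => simp [cancel]
  | cons γ w ih =>
    have ih := ih fun a ha => h a (by simp [ha])
    have hγ := h γ (by simp)
    have hsub := cancel_sublist R w
    rcases hL : cancel R w with _ | ⟨a, L⟩
    · rw [hL] at ih
      simp [cancel, hL, ← ih]
    · rw [hL] at ih hsub
      have ha := h a (by simp [hsub.subset (List.mem_cons_self)])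
      simp only [List.map_cons, cancel, hL, ← ih, ← hγ, ← ha]
      split_ifs <;> simp

/-- The letters of a word that satisfy a predicate. -/
def letters (R : ℤ → Prop) (w : List ℤ) : Finset ℤ := w.toFinset.filter R

theorem mem_letters {R : ℤ → Prop} {w : List ℤ} {x : ℤ} : x ∈ letters R w ↔ x ∈ w ∧ R x := by
  simp [letters]

/-- A quantity that is invariant under the deletion of adjacent subwords `RA` takes the same value
at a word and at its reduced word. -/
theorem invariant_cancel {β : Type*} (F : Finset ℤ → Finset ℤ → β)
    (hF : ∀ X Y x y, x ∈ X → y ∈ Y → x ≤ y → (∀ z ∈ X, z ≤ y → z ≤ x) → (∀ z ∈ Y, x ≤ z → y ≤ z) →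
      F X Y = F (X.erase x) (Y.erase y)) (R : ℤ → Prop) (w u : List ℤ)
    (hw : (u ++ w).Pairwise (· < ·)) :
    F (letters R (u ++ w)) (letters (fun x => ¬ R x) (u ++ w)) =
      F (letters R (u ++ cancel R w)) (letters (fun x => ¬ R x) (u ++ cancel R w)) := by
  induction w generalizing u with
  | nil => simp [cancel]
  | cons γ w ih =>
    -- The prefix `u` absorbs `γ`, so the tail is reduced first. After that `γ` and the first
    -- surviving letter `a` are neighbours, as the hypothesis on `F` requires.
    have h0 := ih (u ++ [γ]) (by simpa using hw)
    simp only [List.append_assoc, List.singleton_append] at h0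
    rw [h0]
    rcases cancel_cons_cases R γ w with ⟨a, L, h1, hR, hRa, h2⟩ | ⟨h, h'⟩
    · have hw' : (u ++ γ :: a :: L).Pairwise (· < ·) := by
        rw [← h1]
        exact hw.sublist (((cancel_sublist R w).cons_cons γ).append_left u)
      rw [h1, h2]
      simp only [List.pairwise_append, List.pairwise_cons, List.mem_cons] at hw'
      obtain ⟨hu, ⟨hγ, ha, hL⟩, huL⟩ := hw'
      have haγ := hγ a (by simp)
      have huγ : ∀ z ∈ u, z < γ := fun z hz => huL z hz γ (by simp)
      have hγL : ∀ z ∈ L, γ < z := fun z hz => hγ z (by simp [hz])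
      rw [hF _ _ γ a]
      · congr 1
        · ext z
          simp only [Finset.mem_erase, mem_letters, List.mem_append, List.mem_cons]
          clear hw ih h0 hF huL hL hu hγ h1 h2
          grind
        · ext z
          simp only [Finset.mem_erase, mem_letters, List.mem_append, List.mem_cons]
          clear hw ih h0 hF huL hL hu hγ h1 h2
          grind
      · simp [mem_letters, hR]
      · simp [mem_letters, hRa]
      · exact haγ.le
      · intro z hz hza
        simp only [mem_letters, List.mem_append, List.mem_cons] at hz
        clear hw ih h0 hF huL hL hu hγ h1 h2
        grind
      · intro z hz hza
        simp only [mem_letters, List.mem_append, List.mem_cons] at hz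
        clear hw ih h0 hF huL hL hu hγ h1 h2
        grind
    · rw [h]

/-! ### Greedy choices -/

/-- The choice made by `y` in `X`: the `r`-largest element that is at most `y` or, if there is
none, the `r`-largest element. -/
def IsPick (r : ℤ → ℤ → Prop) (y : ℤ) (X : Finset ℤ) (z : ℤ) : Prop :=
  z ∈ X ∧ ((r z y ∧ ∀ x ∈ X, r x y → r x z) ∨ ((∀ x ∈ X, ¬ r x y) ∧ ∀ x ∈ X, r x z))

/-- Removes the choice of `y` from `X`. -/
def erasePick (r : ℤ → ℤ → Prop) (X : Finset ℤ) (y : ℤ) : Finset ℤ :=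
  X.filter fun z => ¬ IsPick r y X z

/-- The order relations used in greedy choices. -/
structure IsTotalOrderRel (r : ℤ → ℤ → Prop) : Prop where
  trans : ∀ a b c, r a b → r b c → r a c
  total : ∀ a b, r a b ∨ r b a
  antisymm : ∀ a b, r a b → r b a → a = b

/-- The two cases of the exchange algorithm are the same greedy procedure for opposite orders, so
the theory is developed for an abstract `r` and used for `≤` and `≥`. -/
theorem isTotalOrderRel_le : IsTotalOrderRel (· ≤ ·) :=
  ⟨fun _ _ _ => le_trans, le_total, fun _ _ => le_antisymm⟩

theorem isTotalOrderRel_ge : IsTotalOrderRel (· ≥ ·) :=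
  ⟨fun _ _ _ => ge_trans, fun a b => le_total b a, fun _ _ h h' => le_antisymm h' h⟩

theorem IsTotalOrderRel.exists_max {r : ℤ → ℤ → Prop} (hr : IsTotalOrderRel r) {X : Finset ℤ}
    (hX : X.Nonempty) : ∃ z ∈ X, ∀ x ∈ X, r x z := by
  obtain ⟨tr, tot, -⟩ := hr
  induction hX using Finset.Nonempty.cons_induction with
  | singleton a => exact ⟨a, by simp, by simpa using tot a a⟩
  | cons a s h hs ih =>
    obtain ⟨z, hz, hmax⟩ := ih
    rcases tot a z with h1 | h1
    · exact ⟨z, by simp [hz], by simpa [h1] using hmax⟩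
    · refine ⟨a, by simp, ?_⟩
      simp only [Finset.mem_cons, forall_eq_or_imp]
      exact ⟨(tot a a).elim id id, fun x hx => tr _ _ _ (hmax x hx) h1⟩

theorem IsPick.unique {r : ℤ → ℤ → Prop} (hr : IsTotalOrderRel r) {y : ℤ} {X : Finset ℤ}
    {z z' : ℤ} (h : IsPick r y X z) (h' : IsPick r y X z') : z = z' := by
  have anti := hr.antisymm
  unfold IsPick at h h'
  grind

theorem exists_isPick {r : ℤ → ℤ → Prop} (hr : IsTotalOrderRel r) (y : ℤ) {X : Finset ℤ}
    (hX : X.Nonempty) : ∃ z, IsPick r y X z := by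
  by_cases h : (X.filter fun x => r x y).Nonempty
  · obtain ⟨z, hz, hmax⟩ := hr.exists_max h
    simp only [Finset.mem_filter] at hz hmax
    exact ⟨z, hz.1, Or.inl ⟨hz.2, fun x hx hxy => hmax x ⟨hx, hxy⟩⟩⟩
  · obtain ⟨z, hz, hmax⟩ := hr.exists_max hX
    refine ⟨z, hz, Or.inr ⟨fun x hx hxy => h ⟨x, ?_⟩, hmax⟩⟩
    simp [hx, hxy]

theorem erasePick_eq {r : ℤ → ℤ → Prop} (hr : IsTotalOrderRel r) {y : ℤ} {X : Finset ℤ} {z : ℤ}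
    (h : IsPick r y X z) : erasePick r X y = X.erase z := by
  ext x
  simp only [erasePick, Finset.mem_filter, Finset.mem_erase]
  constructor
  · rintro ⟨hx, hn⟩
    exact ⟨fun e => hn (e ▸ h), hx⟩
  · rintro ⟨hne, hx⟩
    exact ⟨hx, fun h' => hne (h'.unique hr h)⟩

theorem IsPick.erase {r : ℤ → ℤ → Prop} {y x z : ℤ} {X : Finset ℤ} (h : IsPick r y X z)
    (hne : z ≠ x) : IsPick r y (X.erase x) z := by
  unfold IsPick at h ⊢
  grind

/-- Order independence of greedy choices. If `y` and `y'` choose different elements, neither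
deletion affects the other choice. -/
theorem erasePick_right_comm {r : ℤ → ℤ → Prop} (hr : IsTotalOrderRel r) (X : Finset ℤ)
    (y y' : ℤ) : erasePick r (erasePick r X y) y' = erasePick r (erasePick r X y') y := by
  rcases X.eq_empty_or_nonempty with rfl | hX
  · rfl
  obtain ⟨x, hx⟩ := exists_isPick hr y hX
  obtain ⟨x', hx'⟩ := exists_isPick hr y' hX
  rw [erasePick_eq hr hx, erasePick_eq hr hx']
  by_cases hne : x = x'
  · subst hne
    -- If both want `x`, whoever comes second faces `X.erase x`, and there both make the same
    -- choice: the next element below `x`, or the largest one if there is none below `x`.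
    have key : ∀ z, IsPick r y (X.erase x) z ↔ IsPick r y' (X.erase x) z := by
      obtain ⟨tr, tot, anti⟩ := hr
      intro z
      unfold IsPick at hx hx' ⊢
      grind
    simp only [erasePick, key]
  · rw [erasePick_eq hr (hx'.erase (Ne.symm hne)), erasePick_eq hr (hx.erase hne),
      Finset.erase_right_comm]

/-- The elements left over when the elements of a list successively choose elements of `X`. -/
def leftover (r : ℤ → ℤ → Prop) (X : Finset ℤ) (ys : List ℤ) : Finset ℤ :=
  ys.foldl (erasePick r) X

theorem leftover_perm {r : ℤ → ℤ → Prop} (hr : IsTotalOrderRel r) (X : Finset ℤ)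
    {ys ys' : List ℤ} (h : ys.Perm ys') : leftover r X ys = leftover r X ys' := by
  have : RightCommutative (erasePick r) := ⟨erasePick_right_comm hr⟩
  exact h.foldl_eq X

/-- `leftover`, for a finite set of choosing elements. -/
def leftoverSet (r : ℤ → ℤ → Prop) (X Y : Finset ℤ) : Finset ℤ := leftover r X Y.toList

/-- By order independence any `y` may be taken as the first to choose. This is what allows
cancelling pairs to be removed one at a time. -/
theorem leftoverSet_erase {r : ℤ → ℤ → Prop} (hr : IsTotalOrderRel r) {X Y : Finset ℤ} {x y : ℤ}
    (hy : y ∈ Y) (h : IsPick r y X x) :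
    leftoverSet r X Y = leftoverSet r (X.erase x) (Y.erase y) := by
  have hp : Y.toList.Perm (y :: (Y.erase y).toList) := by
    rw [List.perm_ext_iff_of_nodup Y.nodup_toList]
    · intro z
      by_cases hz : z = y <;> simp [hz, hy]
    · simp [Finset.nodup_toList]
  rw [leftoverSet, leftover_perm hr X hp, leftoverSet, leftover, List.foldl_cons,
    erasePick_eq hr h, leftover]

theorem leftover_subset {r : ℤ → ℤ → Prop} (X : Finset ℤ) (ys : List ℤ) :
    leftover r X ys ⊆ X := by
  induction ys generalizing X with
  | nil => exact subset_rfl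
  | cons y ys ih => exact (ih _).trans (Finset.filter_subset _ _)

theorem leftoverSet_subset {r : ℤ → ℤ → Prop} (X Y : Finset ℤ) : leftoverSet r X Y ⊆ X :=
  leftover_subset X _

theorem card_leftoverSet {r : ℤ → ℤ → Prop} (hr : IsTotalOrderRel r) (X Y : Finset ℤ) :
    (leftoverSet r X Y).card = X.card - Y.card := by
  have : ∀ ys : List ℤ, ∀ X, (leftover r X ys).card = X.card - ys.length := by
    intro ys
    induction ys with
    | nil => intro X; rfl
    | cons y ys ih =>
      intro X
      rw [leftover, List.foldl_cons]
      refine (ih _).trans ?_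
      rcases X.eq_empty_or_nonempty with rfl | hX
      · simp [erasePick]
      · obtain ⟨x, hx⟩ := exists_isPick hr y hX
        rw [erasePick_eq hr hx, Finset.card_erase_of_mem hx.1, List.length_cons]
        omega
  rw [leftoverSet, this, Finset.length_toList]

/-- Common elements choose each other. -/
theorem leftoverSet_sdiff {r : ℤ → ℤ → Prop} (hr : IsTotalOrderRel r) (X Y : Finset ℤ) :
    leftoverSet r X Y = leftoverSet r (X \ Y) (Y \ X) := by
  induction h : (X ∩ Y).card generalizing X Y with
  | zero =>
    have hd : Disjoint X Y := by
      rw [Finset.disjoint_iff_inter_eq_empty]; exact Finset.card_eq_zero.1 h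
    rw [Finset.sdiff_eq_self_of_disjoint hd, Finset.sdiff_eq_self_of_disjoint hd.symm]
  | succ n ih =>
    obtain ⟨z, hz⟩ : (X ∩ Y).Nonempty := by rw [← Finset.card_pos]; omega
    obtain ⟨hX, hY⟩ := Finset.mem_inter.1 hz
    -- A common element `z` chooses itself, so it can be erased from both sets.
    have hp : IsPick r z X z := ⟨hX, Or.inl ⟨(hr.total z z).elim id id, fun _ _ h => h⟩⟩
    have hi : X.erase z ∩ Y.erase z = (X ∩ Y).erase z := by ext; simp; tauto
    rw [leftoverSet_erase hr hY hp, ih _ _ (by rw [hi, Finset.card_erase_of_mem hz]; omega)]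
    congr 1 <;> (ext w; simp only [Finset.mem_sdiff, Finset.mem_erase]; grind)

/-- Every chooser lies below all of `l`, so only the fallback rule applies and the largest remaining
element is taken each time. The truncated subtraction covers the case of too many choosers. -/
theorem leftoverSet_of_gt (l : List ℤ) (hl : l.Pairwise (· < ·)) (Y : Finset ℤ)
    (h : ∀ y ∈ Y, ∀ x ∈ l, y < x) :
    leftoverSet (· ≤ ·) l.toFinset Y = (l.take (l.length - Y.card)).toFinset := by
  have key : ∀ ys : List ℤ, (∀ y ∈ ys, ∀ x ∈ l, y < x) →
      leftover (· ≤ ·) l.toFinset ys = (l.take (l.length - ys.length)).toFinset := by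
    intro ys
    induction ys using List.reverseRecOn with
    | nil => simp [leftover]
    | append_singleton ys y ih =>
      intro h
      rw [leftover, List.foldl_append]
      have ih := ih fun y hy => h y (by simp [hy])
      rw [leftover] at ih
      rw [ih, List.foldl_cons, List.foldl_nil, List.length_append, List.length_singleton]
      rcases Nat.eq_zero_or_pos (l.length - ys.length) with h0 | h0
      · rw [h0, show l.length - (ys.length + 1) = 0 by omega]
        rfl
      · set k := l.length - (ys.length + 1) with hk
        rw [show l.length - ys.length = k + 1 by omega]
        have hkl : k < l.length := by omega
        rw [List.take_succ_eq_append_getElem hkl]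
        have hp : IsPick (· ≤ ·) y (l.take k ++ [l[k]]).toFinset l[k] := by
          have hsub : (l.take k ++ [l[k]]).Pairwise (· < ·) := by
            rw [← List.take_succ_eq_append_getElem hkl]
            exact hl.sublist (List.take_sublist _ _)
          refine ⟨by rw [List.toFinset_append]; exact Finset.mem_union_right _ (by simp),
            Or.inr ⟨?_, ?_⟩⟩
          · intro x hx
            rw [← List.take_succ_eq_append_getElem hkl, List.mem_toFinset] at hx
            exact not_le.2 (h y (by simp) x (List.mem_of_mem_take hx))
          · intro x hx
            simp only [List.toFinset_append, Finset.mem_union, List.mem_toFinset,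
              List.mem_singleton] at hx
            rcases hx with hx | rfl
            · exact ((List.pairwise_append.1 hsub).2.2 x hx _ (by simp)).le
            · exact le_rfl
        rw [erasePick_eq isTotalOrderRel_le hp]
        have hnd : l[k] ∉ l.take k := by
          have := hl.imp (S := (· ≠ ·)) (fun h => h.ne)
          have h2 : (l.take (k + 1)).Nodup := List.Nodup.sublist (List.take_sublist _ _) this
          rw [List.take_succ_eq_append_getElem hkl, List.nodup_append] at h2
          intro hm
          exact h2.2.2 _ hm _ (by simp) rfl
        ext z
        simp only [List.toFinset_append, Finset.mem_erase, Finset.mem_union, List.mem_toFinset,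
          List.mem_singleton]
        grind
  rw [leftoverSet, key _ (by simpa using h), Finset.length_toList]

/-- The mirror image of `leftoverSet_of_gt`: every chooser lies above `l`, and the fallback takes
the smallest remaining element. -/
theorem leftoverSet_of_lt (l : List ℤ) (hl : l.Pairwise (· < ·)) (Y : Finset ℤ)
    (h : ∀ y ∈ Y, ∀ x ∈ l, x < y) :
    leftoverSet (· ≥ ·) l.toFinset Y = (l.drop Y.card).toFinset := by
  have key : ∀ ys : List ℤ, (∀ y ∈ ys, ∀ x ∈ l, x < y) →
      leftover (· ≥ ·) l.toFinset ys = (l.drop ys.length).toFinset := by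
    clear h
    intro ys
    induction ys generalizing l with
    | nil => simp [leftover]
    | cons y ys ih =>
      intro h
      rcases l with _ | ⟨x, l⟩
      · have h0 : ∀ ys : List ℤ, leftover (· ≥ ·) ∅ ys = ∅ := by
          intro ys
          induction ys with
          | nil => rfl
          | cons y ys ih => exact ih
        simpa using h0 (y :: ys)
      · rw [List.pairwise_cons] at hl
        have hp : IsPick (· ≥ ·) y (x :: l).toFinset x := by
          refine ⟨by simp, Or.inr ⟨?_, ?_⟩⟩
          · intro z hz
            exact not_le.2 (h y (by simp) z (by simpa using hz))
          · intro z hz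
            simp only [List.toFinset_cons, Finset.mem_insert, List.mem_toFinset] at hz
            rcases hz with rfl | hz
            · exact le_rfl
            · exact (hl.1 z hz).le
        rw [leftover, List.foldl_cons, erasePick_eq isTotalOrderRel_ge hp]
        have hx : x ∉ l := fun hm => lt_irrefl _ (hl.1 x hm)
        have he : (x :: l).toFinset.erase x = l.toFinset := by
          rw [List.toFinset_cons, Finset.erase_insert (by simpa using hx)]
        rw [he]
        exact (ih l hl.2 fun y hy z hz => h y (by simp [hy]) z (by simp [hz])).trans (by simp)
  rw [leftoverSet, key _ (by simpa using h), Finset.length_toList]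

/-! ### Charges of symbols -/

/-- The charge of a symbol. -/
def charge (X : BetaSymbol) : ℤ := (symbolEquiv.symm X).2

theorem mem_beads {X : BetaSymbol} {N x : ℤ} : x ∈ beads X N ↔ x ∈ X.1 ∧ N ≤ x := by
  simp [beads]

theorem card_beads_sub_one (X : BetaSymbol) (N : ℤ) (h : N - 1 ∈ X.1) :
    (beads X (N - 1)).card = (beads X N).card + 1 := by
  have : beads X (N - 1) = insert (N - 1) (beads X N) := by
    ext x
    simp only [mem_beads, Finset.mem_insert]
    constructor
    · rintro ⟨h1, h2⟩
      by_cases hx : x = N - 1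
      · exact Or.inl hx
      · exact Or.inr ⟨h1, by omega⟩
    · rintro (rfl | ⟨h1, h2⟩)
      · exact ⟨h, le_rfl⟩
      · exact ⟨h1, by omega⟩
  rw [this, Finset.card_insert_of_notMem]
  simp [mem_beads]

theorem card_beads_sub (X : BetaSymbol) (N : ℤ) (h : ∀ x < N, x ∈ X.1) (k : ℕ) :
    (beads X (N - k)).card = (beads X N).card + k := by
  induction k with
  | zero => simp
  | succ k ih =>
    have := card_beads_sub_one X (N - k) (h _ (by omega))
    rw [show N - ((k + 1 : ℕ) : ℤ) = N - k - 1 by push_cast; ring, this, ih]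
    ring

/-- Lowering `N` by `k` inside the full tail adds `k` beads, so the right-hand side does not depend
on `N` and can be computed far to the left. -/
theorem charge_eq (X : BetaSymbol) (N : ℤ) (h : ∀ x < N, x ∈ X.1) :
    charge X = N + (beads X N).card := by
  obtain ⟨⟨lam, m⟩, rfl⟩ := toSymbol_surjective X
  have hc : charge (toSymbol (lam, m)) = m := by
    change (symbolEquiv.symm (symbolEquiv (lam, m))).2 = m
    rw [Equiv.symm_apply_apply]
  rw [hc]
  -- From `m - colLen 0` downwards all beads belong to empty rows, so beyond such a bound the beads
  -- come from an initial segment of the rows.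
  obtain ⟨k, hk⟩ : ∃ k : ℕ, N - k ≤ m - lam.colLen 0 := ⟨(N - (m - lam.colLen 0)).toNat, by omega⟩
  have h1 := card_beads_sub _ N h k
  have h2 : beads (toSymbol (lam, m)) (N - k) = (Finset.range (m - (N - k)).toNat).image
      fun a : ℕ => (lam.rowLen a : ℤ) - (a + 1) + m := by
    ext x
    simp only [mem_beads, Finset.mem_image, Finset.mem_range]
    constructor
    · rintro ⟨⟨a, rfl⟩, hx⟩
      refine ⟨a, ?_, rfl⟩
      by_contra hc
      dsimp only at hx
      rw [rowLen_eq_zero lam (by omega)] at hx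
      omega
    · rintro ⟨a, ha, rfl⟩
      exact ⟨⟨a, rfl⟩, by omega⟩
  rw [h2, Finset.card_image_of_injective _ (betaSet_strictAnti lam m).injective,
    Finset.card_range] at h1
  omega

theorem charge_ofBeads (N : ℤ) (F : Finset ℤ) (hF : ∀ x ∈ F, N ≤ x) :
    charge (ofBeads N F) = N + F.card := by
  rw [charge_eq (ofBeads N F) N fun x hx => Or.inl hx]
  congr 3
  ext x
  rw [mem_beads]
  change ((x < N ∨ x ∈ F) ∧ N ≤ x) ↔ _
  grind

/-- Moving one bead does not change the charge. -/
theorem charge_eq_of_move (X X' : BetaSymbol) (a b : ℤ) (ha : a ∈ X.1) (hb : b ∉ X.1)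
    (h : ∀ x, x ∈ X'.1 ↔ x = b ∨ (x ∈ X.1 ∧ x ≠ a)) : charge X' = charge X := by
  obtain ⟨N, hN⟩ := X.2.2
  set N' := min N (min a b)
  have h1 : ∀ x < N', x ∈ X.1 := fun x hx => hN x (by omega)
  have h2 : ∀ x < N', x ∈ X'.1 := fun x hx => (h x).2 (Or.inr ⟨h1 x hx, by omega⟩)
  have h3 : beads X' N' = insert b ((beads X N').erase a) := by
    ext x
    simp only [mem_beads, h, Finset.mem_insert, Finset.mem_erase]
    constructor
    · rintro ⟨h | h, h'⟩ <;> tauto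
    · rintro (rfl | h')
      · exact ⟨Or.inl rfl, by omega⟩
      · tauto
  have ha' : a ∈ beads X N' := mem_beads.2 ⟨ha, by omega⟩
  rw [charge_eq X' N' h2, charge_eq X N' h1, h3, Finset.card_insert_of_notMem,
    Finset.card_erase_add_one ha']
  simp [mem_beads, hb]

/-! ### The exchange algorithm -/

theorem leftover_cons {r : ℤ → ℤ → Prop} (hr : IsTotalOrderRel r) {X : Finset ℤ} {y x : ℤ}
    (h : IsPick r y X x) (ys : List ℤ) :
    leftover r X (y :: ys) = leftover r (X.erase x) ys := by
  rw [leftover, List.foldl_cons, erasePick_eq hr h, leftover]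

theorem sdiff_leftover_cons {r : ℤ → ℤ → Prop} (hr : IsTotalOrderRel r) {X : Finset ℤ} {y x : ℤ}
    (h : IsPick r y X x) (ys : List ℤ) :
    insert x (X.erase x \ leftover r (X.erase x) ys) = X \ leftover r X (y :: ys) := by
  rw [leftover_cons hr h]
  have hs := leftover_subset (r := r) (X.erase x) ys
  ext z
  have := @hs z
  simp only [Finset.mem_insert, Finset.mem_sdiff, Finset.mem_erase] at this ⊢
  have := h.1
  grind

theorem chooseBelow_eq (ys : List ℤ) (X : Finset ℤ) :
    chooseBelow ys X = X \ leftover (· ≤ ·) X ys := by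
  induction ys generalizing X with
  | nil => simp [chooseBelow, leftover]
  | cons y ys ih =>
    have key : ∀ x, IsPick (· ≤ ·) y X x →
        insert x (chooseBelow ys (X.erase x)) = X \ leftover (· ≤ ·) X (y :: ys) := by
      intro x hx
      rw [ih, sdiff_leftover_cons isTotalOrderRel_le hx]
    rw [chooseBelow]
    split_ifs with h h'
    · have h1 := Finset.max'_mem _ h
      rw [Finset.mem_filter] at h1
      exact key _ ⟨h1.1, Or.inl ⟨h1.2, fun x hx hxy => Finset.le_max' _ _ (by simp [hx, hxy])⟩⟩
    · refine key _ ⟨Finset.max'_mem _ h', Or.inr ⟨fun x hx hxy => h ⟨x, by simp [hx, hxy]⟩,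
        fun x hx => Finset.le_max' _ _ hx⟩⟩
    · rw [Finset.not_nonempty_iff_eq_empty.1 h', Finset.empty_sdiff]

theorem chooseAbove_eq (ys : List ℤ) (X : Finset ℤ) :
    chooseAbove ys X = X \ leftover (· ≥ ·) X ys := by
  induction ys generalizing X with
  | nil => simp [chooseAbove, leftover]
  | cons y ys ih =>
    have key : ∀ x, IsPick (· ≥ ·) y X x →
        insert x (chooseAbove ys (X.erase x)) = X \ leftover (· ≥ ·) X (y :: ys) := by
      intro x hx
      rw [ih, sdiff_leftover_cons isTotalOrderRel_ge hx]
    rw [chooseAbove]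
    split_ifs with h h'
    · have h1 := Finset.min'_mem _ h
      rw [Finset.mem_filter] at h1
      exact key _ ⟨h1.1, Or.inl ⟨h1.2, fun x hx hxy => Finset.min'_le _ _ (by
        simp only [Finset.mem_filter]; exact ⟨hx, hxy⟩)⟩⟩
    · refine key _ ⟨Finset.min'_mem _ h', Or.inr ⟨fun x hx hxy => h ⟨x, by
        simp only [Finset.mem_filter]; exact ⟨hx, hxy⟩⟩, fun x hx => Finset.min'_le _ _ hx⟩⟩
    · rw [Finset.not_nonempty_iff_eq_empty.1 h', Finset.empty_sdiff]

/-- Passing from chosen elements to the complementary leftover set makes the increasing order of the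
choosers irrelevant: `sort` can be replaced by any enumeration. -/
theorem exchangeFinset_of_le {Y X : Finset ℤ} (h : Y.card ≤ X.card) :
    exchangeFinset Y X = (leftoverSet (· ≤ ·) X Y ∪ Y, X \ leftoverSet (· ≤ ·) X Y) := by
  have hs : leftover (· ≤ ·) X (Y.sort (· ≤ ·)) = leftoverSet (· ≤ ·) X Y :=
    leftover_perm isTotalOrderRel_le X (Finset.sort_perm_toList _ _)
  rw [exchangeFinset, if_pos h, chooseBelow_eq, hs,
    Finset.sdiff_sdiff_eq_self (leftoverSet_subset X Y)]

theorem exchangeFinset_of_lt {Y X : Finset ℤ} (h : X.card < Y.card) :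
    exchangeFinset Y X = (Y \ leftoverSet (· ≥ ·) Y X, leftoverSet (· ≥ ·) Y X ∪ X) := by
  have hs : leftover (· ≥ ·) Y (X.sort (· ≤ ·)) = leftoverSet (· ≥ ·) Y X :=
    leftover_perm isTotalOrderRel_ge Y (Finset.sort_perm_toList _ _)
  rw [exchangeFinset, if_neg (not_le.2 h), chooseAbove_eq, hs,
    Finset.sdiff_sdiff_eq_self (leftoverSet_subset Y X)]

theorem tailBound_spec (X Y : BetaSymbol) {x : ℤ} (hx : x < tailBound X Y) : x ∈ X.1 ∧ x ∈ Y.1 :=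
  (exists_tail X Y).choose_spec x hx

/-- Common elements choose each other, so nothing in `Y` is left over. Hence the unions in the
exchange are disjoint and cardinalities add up. -/
theorem disjoint_leftoverSet {r : ℤ → ℤ → Prop} (hr : IsTotalOrderRel r) (X Y : Finset ℤ) :
    Disjoint (leftoverSet r X Y) Y := by
  rw [leftoverSet_sdiff hr]
  exact Finset.disjoint_of_subset_left (leftoverSet_subset _ _) Finset.sdiff_disjoint

theorem charge_exchange (Y X : BetaSymbol) :
    charge (exchange Y X).1 = charge X ∧ charge (exchange Y X).2 = charge Y := by
  set N := tailBound Y X with hN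
  have hY : ∀ x ∈ beads Y N, N ≤ x := fun x hx => (mem_beads.1 hx).2
  have hX : ∀ x ∈ beads X N, N ≤ x := fun x hx => (mem_beads.1 hx).2
  rw [charge_eq X N fun x hx => (tailBound_spec Y X hx).2,
    charge_eq Y N fun x hx => (tailBound_spec Y X hx).1, exchange]
  dsimp only
  rw [← hN]
  rcases le_or_gt (beads Y N).card (beads X N).card with h | h
  · have hs := leftoverSet_subset (r := (· ≤ ·)) (beads X N) (beads Y N)
    have hc := card_leftoverSet isTotalOrderRel_le (beads X N) (beads Y N)
    rw [exchangeFinset_of_le h, charge_ofBeads, charge_ofBeads,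
      Finset.card_union_of_disjoint (disjoint_leftoverSet isTotalOrderRel_le _ _),
      Finset.card_sdiff_of_subset hs, hc]
    · omega
    · exact fun x hx => hX x (Finset.sdiff_subset hx)
    · exact fun x hx => (Finset.mem_union.1 hx).elim (fun h => hX x (hs h)) (hY x)
  · have hs := leftoverSet_subset (r := (· ≥ ·)) (beads Y N) (beads X N)
    have hc := card_leftoverSet isTotalOrderRel_ge (beads Y N) (beads X N)
    rw [exchangeFinset_of_lt h, charge_ofBeads, charge_ofBeads,
      Finset.card_union_of_disjoint (disjoint_leftoverSet isTotalOrderRel_ge _ _),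
      Finset.card_sdiff_of_subset hs, hc]
    · omega
    · exact fun x hx => (Finset.mem_union.1 hx).elim (fun h => hY x (hs h)) (hX x)
    · exact fun x hx => hY x (Finset.sdiff_subset hx)

/-- The exchange algorithm in terms of the reduced word `A^k R^q`: it becomes `A^q R^k`. -/
theorem mem_exchange (Y X : BetaSymbol) (w : List ℤ) (hw : w.Pairwise (· < ·))
    (hmem : ∀ p, p ∈ w ↔ ¬ (p ∈ X.1 ↔ p ∈ Y.1)) (k q : ℕ)
    (hlen : (cancel (· ∈ X.1) w).length = k + q)
    (hA : ∀ p ∈ (cancel (· ∈ X.1) w).take k, p ∉ X.1)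
    (hR : ∀ p ∈ (cancel (· ∈ X.1) w).drop k, p ∈ X.1) (p : ℤ) :
    (p ∈ (exchange Y X).1.1 ↔ p ∈ (cancel (· ∈ X.1) w).take q ∨
        (p ∉ cancel (· ∈ X.1) w ∧ p ∈ Y.1)) ∧
      (p ∈ (exchange Y X).2.1 ↔ p ∈ (cancel (· ∈ X.1) w).drop q ∨
        (p ∉ cancel (· ∈ X.1) w ∧ p ∈ X.1)) := by
  set L := cancel (· ∈ X.1) w with hL
  set N := tailBound Y X with hN
  have hNX : ∀ x < N, x ∈ X.1 := fun x hx => (tailBound_spec Y X hx).2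
  have hNY : ∀ x < N, x ∈ Y.1 := fun x hx => (tailBound_spec Y X hx).1
  have hsub : L.Sublist w := cancel_sublist _ w
  have hLs : L.Pairwise (· < ·) := hw.sublist hsub
  have hLnd : L.Nodup := hLs.imp fun h => h.ne
  have hLeq : L.take k ++ L.drop k = L := List.take_append_drop k L
  have hsplit : (L.take k ++ L.drop k).Pairwise (· < ·) := by rwa [hLeq]
  have hlt := (List.pairwise_append.1 hsplit).2.2
  -- the words of the bead sets and of their reductions
  have e1 : letters (· ∈ X.1) w = beads X N \ beads Y N := by
    ext x
    have := hNY x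
    simp only [mem_letters, hmem, Finset.mem_sdiff, mem_beads]
    grind
  have e2 : letters (· ∉ X.1) w = beads Y N \ beads X N := by
    ext x
    have := hNX x
    simp only [mem_letters, hmem, Finset.mem_sdiff, mem_beads]
    grind
  have e3 : letters (· ∈ X.1) L = (L.drop k).toFinset := by
    ext x
    rw [mem_letters, List.mem_toFinset, ← hLeq, List.mem_append, hLeq]
    have := hA x
    have := hR x
    tauto
  have e4 : letters (· ∉ X.1) L = (L.take k).toFinset := by
    ext x
    rw [mem_letters, List.mem_toFinset, ← hLeq, List.mem_append, hLeq]
    have := hA x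
    have := hR x
    tauto
  have c3 : (L.drop k).toFinset.card = q := by
    rw [List.toFinset_card_of_nodup (hLnd.sublist (List.drop_sublist _ _)), List.length_drop]
    omega
  have c4 : (L.take k).toFinset.card = k := by
    rw [List.toFinset_card_of_nodup (hLnd.sublist (List.take_sublist _ _)), List.length_take]
    omega
  -- Any quantity invariant under pairing off an `R` with the next `A` may be computed on `A^k R^q`.
  -- It is used for the difference of cardinalities and for the two leftover sets.
  have inv : ∀ {β : Type} (F : Finset ℤ → Finset ℤ → β),
      (∀ X Y x y, x ∈ X → y ∈ Y → x ≤ y → (∀ z ∈ X, z ≤ y → z ≤ x) →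
        (∀ z ∈ Y, x ≤ z → y ≤ z) → F X Y = F (X.erase x) (Y.erase y)) →
      F (beads X N \ beads Y N) (beads Y N \ beads X N)
        = F (L.drop k).toFinset (L.take k).toFinset := by
    intro β F hF
    have := invariant_cancel F hF (· ∈ X.1) w [] (by simpa using hw)
    simp only [List.nil_append] at this
    rwa [e1, e2, ← hL, e3, e4] at this
  -- This matches the case distinction of the exchange algorithm with the comparison of `k` and `q`.
  have hcard : ((beads X N).card : ℤ) - (beads Y N).card = q - k := by
    have h1 := inv (fun X Y => (X.card : ℤ) - Y.card) (by
      intro X Y x y hx hy _ _ _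
      have := Finset.card_erase_add_one hx
      have := Finset.card_erase_add_one hy
      omega)
    rw [c3, c4] at h1
    have h2 := Finset.card_sdiff_add_card_inter (beads X N) (beads Y N)
    have h3 := Finset.card_sdiff_add_card_inter (beads Y N) (beads X N)
    rw [Finset.inter_comm] at h3
    omega
  have hbX : p ∈ X.1 ↔ p < N ∨ p ∈ beads X N := by
    have := hNX p
    rw [mem_beads]
    grind
  have hbY : p ∈ Y.1 ↔ p < N ∨ p ∈ beads Y N := by
    have := hNY p
    rw [mem_beads]
    grind
  have hLmem : p ∈ L ↔ p ∈ L.take k ∨ p ∈ L.drop k := by rw [← List.mem_append, hLeq]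
  have hLw : p ∈ L → ¬ (p ∈ X.1 ↔ p ∈ Y.1) := fun h => (hmem p).1 (hsub.subset h)
  have hnlt : p ∈ beads X N → ¬ p < N := fun h => not_lt.2 (mem_beads.1 h).2
  have hnlt' : p ∈ beads Y N → ¬ p < N := fun h => not_lt.2 (mem_beads.1 h).2
  have hAp := hA p
  have hRp := hR p
  change (p < N ∨ p ∈ (exchangeFinset (beads Y N) (beads X N)).1 ↔ _) ∧
    (p < N ∨ p ∈ (exchangeFinset (beads Y N) (beads X N)).2 ↔ _)
  rcases le_or_gt k q with hkq | hkq
  -- The `k` letters `A` choose the last `k` letters `R`; the first `q - k` letters `R` are left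
  -- over and join the lower runner.
  · have hV : leftoverSet (· ≤ ·) (beads X N) (beads Y N)
        = ((L.drop k).take (q - k)).toFinset := by
      rw [leftoverSet_sdiff isTotalOrderRel_le, inv (leftoverSet (· ≤ ·)),
        leftoverSet_of_gt _ (hLs.sublist (List.drop_sublist _ _)), c4, List.length_drop, hlen]
      · congr 3; omega
      · intro y hy x hx
        exact hlt y (by simpa using hy) x hx
      · intro X Y x y hx hy hxy h1 h2
        exact leftoverSet_erase isTotalOrderRel_le hy ⟨hx, Or.inl ⟨hxy, h1⟩⟩
    have t1 : L.take q = L.take k ++ (L.drop k).take (q - k) := by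
      rw [← List.take_add]; congr 1; omega
    have t2 : L.drop k = (L.drop k).take (q - k) ++ L.drop q := by
      conv_lhs => rw [← List.take_append_drop (q - k) (L.drop k)]
      rw [List.drop_drop]; congr 2; omega
    have t3 : p ∈ L.drop q → p ∉ (L.drop k).take (q - k) := by
      have h1 : (L.drop k).Nodup := hLnd.sublist (List.drop_sublist _ _)
      rw [t2, List.nodup_append] at h1
      exact fun h h' => h1.2.2 p h' p h rfl
    have t4 : p ∈ L.drop k ↔ p ∈ (L.drop k).take (q - k) ∨ p ∈ L.drop q := by
      rw [← List.mem_append, ← t2]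
    rw [exchangeFinset_of_le (by omega), hV, t1]
    simp only [Finset.mem_union, Finset.mem_sdiff, List.mem_toFinset, List.mem_append]
    -- With `p` fixed, all that remains is propositional logic in the membership statements.
    generalize (p ∈ (L.drop k).take (q - k)) = a at *
    generalize (p ∈ L.drop k) = b at *
    generalize (p ∈ L.take k) = c at *
    generalize (p ∈ L.drop q) = d at *
    generalize (p ∈ beads X N) = f at *
    generalize (p ∈ beads Y N) = g at *
    clear inv e1 e2 e3 e4 hA hR hmem hNX hNY hlt hsplit t1 t2 hV
    constructor <;> grind
  -- Here the `q` letters `R` choose the first `q` letters `A`; the last `k - q` letters `A` join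
  -- the upper runner.
  · have hV : leftoverSet (· ≥ ·) (beads Y N) (beads X N)
        = ((L.take k).drop q).toFinset := by
      rw [leftoverSet_sdiff isTotalOrderRel_ge, inv (fun X Y => leftoverSet (· ≥ ·) Y X),
        leftoverSet_of_lt _ (hLs.sublist (List.take_sublist _ _)), c3]
      · intro y hy x hx
        exact hlt x hx y (by simpa using hy)
      · intro X Y x y hx hy hxy h1 h2
        exact leftoverSet_erase isTotalOrderRel_ge hx ⟨hy, Or.inl ⟨hxy, h2⟩⟩
    have t1 : L.take k = L.take q ++ (L.take k).drop q := by
      conv_lhs => rw [← List.take_append_drop q (L.take k)]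
      rw [List.take_take]; congr 2; omega
    have t2 : L.drop q = (L.take k).drop q ++ L.drop k := by
      conv_lhs => rw [← hLeq]
      rw [List.drop_append_of_le_length]
      rw [List.length_take]; omega
    have t3 : p ∈ L.take q → p ∉ (L.take k).drop q := by
      have h1 : (L.take k).Nodup := hLnd.sublist (List.take_sublist _ _)
      rw [t1, List.nodup_append] at h1
      exact fun h h' => h1.2.2 p h p h' rfl
    have t4 : p ∈ L.take k ↔ p ∈ L.take q ∨ p ∈ (L.take k).drop q := by
      rw [← List.mem_append, ← t1]
    rw [exchangeFinset_of_lt (by omega), hV, t2]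
    simp only [Finset.mem_union, Finset.mem_sdiff, List.mem_toFinset, List.mem_append]
    generalize (p ∈ (L.take k).drop q) = a at *
    generalize (p ∈ L.drop k) = b at *
    generalize (p ∈ L.take k) = c at *
    generalize (p ∈ L.take q) = d at *
    generalize (p ∈ beads X N) = f at *
    generalize (p ∈ beads Y N) = g at *
    clear inv e1 e2 e3 e4 hA hR hmem hNX hNY hlt hsplit t1 t2 hV
    constructor <;> grind

/-! ### Addable and removable nodes in terms of beads -/

theorem mem_nodes_iff {l : ℕ} {lam : MultiPartition l} {γ : Node l} :
    γ ∈ nodes lam ↔ γ.2.1 < (lam γ.2.2).rowLen γ.1 :=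
  YoungDiagram.mem_iff_lt_rowLen

theorem rowLen_of_insert {l : ℕ} {lam mu : MultiPartition l} {γ : Node l} (hγ : γ ∉ nodes lam)
    (h : nodes mu = insert γ (nodes lam)) :
    (lam γ.2.2).rowLen γ.1 = γ.2.1 ∧ (mu γ.2.2).rowLen γ.1 = γ.2.1 + 1 ∧
      ∀ a c, (a, c) ≠ (γ.1, γ.2.2) → (mu c).rowLen a = (lam c).rowLen a := by
  obtain ⟨a, b, c⟩ := γ
  have key : ∀ a' b' c', b' < (mu c').rowLen a' ↔
      (a' = a ∧ b' = b ∧ c' = c) ∨ b' < (lam c').rowLen a' := by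
    intro a' b' c'
    have := Set.ext_iff.1 h (a', b', c')
    rw [Set.mem_insert_iff, mem_nodes_iff, mem_nodes_iff] at this
    simpa using this
  rw [mem_nodes_iff] at hγ
  dsimp only at hγ ⊢
  have k1 : b < (mu c).rowLen a := (key a b c).2 (Or.inl ⟨rfl, rfl, rfl⟩)
  have k2 := key a (b + 1) c
  have k3 := key a ((lam c).rowLen a) c
  simp only [true_and, and_true] at k2 k3
  refine ⟨by omega, by omega, fun a' c' hne => ?_⟩
  have hne' : ¬ (a' = a ∧ c' = c) := by simpa using hne
  have k4 := key a' ((mu c').rowLen a') c'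
  have k5 := key a' ((lam c').rowLen a') c'
  have : ∀ b', ¬ (a' = a ∧ b' = b ∧ c' = c) := fun b' h => hne' ⟨h.1, h.2.2⟩
  simp only [this, false_or] at k4 k5
  omega

theorem nodes_eq_insert {l : ℕ} {lam mu : MultiPartition l} {a : ℕ} {c : Fin l}
    (h1 : (mu c).rowLen a = (lam c).rowLen a + 1)
    (h2 : ∀ a' c', (a', c') ≠ (a, c) → (mu c').rowLen a' = (lam c').rowLen a') :
    nodes mu = insert (a, (lam c).rowLen a, c) (nodes lam) := by
  ext ⟨a', b', c'⟩
  rw [Set.mem_insert_iff, mem_nodes_iff, mem_nodes_iff]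
  dsimp only
  by_cases h : (a', c') = (a, c)
  · obtain ⟨rfl, rfl⟩ := Prod.mk.inj h
    rw [h1]
    simp only [Prod.mk.injEq, true_and, and_true]
    omega
  · rw [h2 _ _ h]
    constructor
    · exact Or.inr
    · rintro (h' | h')
      · simp only [Prod.mk.injEq] at h h'
        tauto
      · exact h'

/-- Supplies the multipartition required by `IsAddable` and `IsRemovable` when one row length is
changed by one. -/
theorem exists_setRow {l : ℕ} (lam : MultiPartition l) (c : Fin l) (a v : ℕ)
    (h1 : ∀ a' < a, v ≤ (lam c).rowLen a') (h2 : ∀ a', a < a' → (lam c).rowLen a' ≤ v) :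
    ∃ mu : MultiPartition l, (mu c).rowLen a = v ∧
      ∀ a' c', (a', c') ≠ (a, c) → (mu c').rowLen a' = (lam c').rowLen a' := by
  obtain ⟨d, hd⟩ := exists_rowLen_eq (Function.update (lam c).rowLen a v) (by
    intro x y hxy
    have := (lam c).rowLen_anti x y hxy
    simp only [Function.update_apply]
    split_ifs with hy hx hx
    · exact le_rfl
    · subst hy; exact h1 _ (by omega)
    · subst hx; exact h2 _ (by omega)
    · exact this) (max (a + 1) ((lam c).colLen 0)) (by
    rw [Function.update_of_ne (by omega)]
    exact rowLen_eq_zero _ (le_max_right _ _))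
  refine ⟨Function.update lam c d, by simp [hd], fun a' c' hne => ?_⟩
  by_cases hc : c' = c
  · subst hc
    have : a' ≠ a := fun h => hne (by rw [h])
    simp [hd, this]
  · simp [hc]

/-- The bead at which row `a` of component `c` ends. -/
def rowBead {l : ℕ} (lam : MultiPartition l) (s : MultiCharge l) (c : Fin l) (a : ℕ) : ℤ :=
  ((lam c).rowLen a : ℤ) - (a + 1) + s c

theorem rowBead_injective {l : ℕ} (lam : MultiPartition l) (s : MultiCharge l) (c : Fin l) :
    Function.Injective (rowBead lam s c) := (betaSet_strictAnti (lam c) (s c)).injective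

theorem rowBead_lt {l : ℕ} (lam : MultiPartition l) (s : MultiCharge l) (c : Fin l) {a a' : ℕ}
    (h : a < a') : rowBead lam s c a' < rowBead lam s c a := betaSet_strictAnti (lam c) (s c) h

theorem mem_betaSet_iff {l : ℕ} (lam : MultiPartition l) (s : MultiCharge l) (c : Fin l) (x : ℤ) :
    x ∈ betaSet (lam c) (s c) ↔ ∃ a, rowBead lam s c a = x := Iff.rfl

/-! ### Adding or removing one node as a bead move -/

section Insert

variable {l : ℕ} {lam mu : MultiPartition l} {γ : Node l}

theorem rowBead_of_insert (s : MultiCharge l) (hγ : γ ∉ nodes lam)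
    (h : nodes mu = insert γ (nodes lam)) :
    rowBead lam s γ.2.2 γ.1 = content s γ - 1 ∧ rowBead mu s γ.2.2 γ.1 = content s γ ∧
      ∀ a c, (a, c) ≠ (γ.1, γ.2.2) → rowBead mu s c a = rowBead lam s c a := by
  obtain ⟨h1, h2, h3⟩ := rowLen_of_insert hγ h
  refine ⟨?_, ?_, fun a c hne => ?_⟩
  · rw [rowBead, content, h1]; ring
  · rw [rowBead, content, h2]; push_cast; ring
  · rw [rowBead, rowBead, h3 a c hne]

/-- Lengthening a row by a node moves its bead one step to the right. With rows and columns numbered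
from `0`, the new position is the content of the node. -/
theorem beads_of_insert (s : MultiCharge l) (hγ : γ ∉ nodes lam)
    (h : nodes mu = insert γ (nodes lam)) :
    content s γ - 1 ∈ betaSet (lam γ.2.2) (s γ.2.2) ∧
      content s γ ∉ betaSet (lam γ.2.2) (s γ.2.2) ∧
      ∀ c x, x ∈ betaSet (mu c) (s c) ↔ (c = γ.2.2 ∧ x = content s γ) ∨
        (x ∈ betaSet (lam c) (s c) ∧ ¬ (c = γ.2.2 ∧ x = content s γ - 1)) := by
  obtain ⟨h1, h2, h3⟩ := rowBead_of_insert s hγ h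
  refine ⟨⟨γ.1, h1⟩, ?_, ?_⟩
  · rintro ⟨a, ha⟩
    change rowBead lam s γ.2.2 a = _ at ha
    by_cases hne : a = γ.1
    · rw [hne, h1] at ha; omega
    · rw [← h3 a γ.2.2 (by simpa using hne), ← h2] at ha
      exact hne (rowBead_injective mu s _ ha)
  · intro c x
    rw [mem_betaSet_iff, mem_betaSet_iff]
    constructor
    · rintro ⟨a, rfl⟩
      by_cases hne : (a, c) = (γ.1, γ.2.2)
      · obtain ⟨rfl, rfl⟩ := Prod.mk.inj hne
        exact Or.inl ⟨rfl, h2⟩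
      · rw [h3 a c hne]
        refine Or.inr ⟨⟨a, rfl⟩, ?_⟩
        rintro ⟨rfl, he⟩
        rw [← h1] at he
        exact hne (by rw [rowBead_injective lam s _ he])
    · rintro (⟨rfl, rfl⟩ | ⟨⟨a, rfl⟩, hn⟩)
      · exact ⟨γ.1, h2⟩
      · refine ⟨a, h3 a c ?_⟩
        intro he
        obtain ⟨rfl, rfl⟩ := Prod.mk.inj he
        exact hn ⟨rfl, h1⟩

/-- Reduces statements on removable nodes to the insertion of `γ` into the smaller multipartition.
-/
theorem IsRemovable.exists_insert (h : IsRemovable lam γ) :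
    ∃ mu : MultiPartition l, nodes mu = nodes lam \ {γ} ∧ γ ∉ nodes mu ∧
      nodes lam = insert γ (nodes mu) := by
  obtain ⟨hγ, mu, hmu⟩ := h
  refine ⟨mu, hmu, by simp [hmu], ?_⟩
  rw [hmu, Set.insert_sdiff_singleton, Set.insert_eq_of_mem hγ]

theorem IsAddable.beads (s : MultiCharge l) (h : IsAddable lam γ) :
    content s γ - 1 ∈ betaSet (lam γ.2.2) (s γ.2.2) ∧
      content s γ ∉ betaSet (lam γ.2.2) (s γ.2.2) := by
  obtain ⟨hγ, mu, hmu⟩ := h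
  have := beads_of_insert s hγ hmu
  exact ⟨this.1, this.2.1⟩

theorem IsRemovable.beads (s : MultiCharge l) (h : IsRemovable lam γ) :
    content s γ ∈ betaSet (lam γ.2.2) (s γ.2.2) ∧
      content s γ - 1 ∉ betaSet (lam γ.2.2) (s γ.2.2) := by
  obtain ⟨mu, -, hγ, hmu⟩ := h.exists_insert
  have := (beads_of_insert s hγ hmu).2.2
  rw [this, this]
  refine ⟨Or.inl ⟨rfl, rfl⟩, ?_⟩
  rintro (⟨-, h⟩ | ⟨-, h⟩)
  · omega
  · exact h ⟨rfl, rfl⟩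

theorem IsAddable.rowBead_eq (s : MultiCharge l) (h : IsAddable lam γ) :
    rowBead lam s γ.2.2 γ.1 = content s γ - 1 := by
  obtain ⟨hγ, mu, hmu⟩ := h
  exact (rowBead_of_insert s hγ hmu).1

theorem IsRemovable.rowBead_eq (s : MultiCharge l) (h : IsRemovable lam γ) :
    rowBead lam s γ.2.2 γ.1 = content s γ := by
  obtain ⟨mu, -, hγ, hmu⟩ := h.exists_insert
  exact (rowBead_of_insert s hγ hmu).2.1

/-- An addable or removable node is determined by its content and its component. -/
theorem node_unique (s : MultiCharge l) {γ' : Node l} (h : IsAddable lam γ ∨ IsRemovable lam γ)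
    (h' : IsAddable lam γ' ∨ IsRemovable lam γ') (hc : γ.2.2 = γ'.2.2)
    (hs : content s γ = content s γ') : γ = γ' := by
  have key : γ.1 = γ'.1 := by
    apply rowBead_injective lam s γ.2.2
    rcases h with h | h <;> rcases h' with h' | h'
    · rw [h.rowBead_eq s, hc, h'.rowBead_eq s, hs]
    · exact absurd (hc ▸ hs ▸ (h'.beads s).1) (h.beads s).2
    · exact absurd (hc ▸ hs ▸ (h.beads s).1) (h'.beads s).2
    · rw [h.rowBead_eq s, hc, h'.rowBead_eq s, hs]
  have hb : γ.2.1 = γ'.2.1 := by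
    rw [content, content, hc, key] at hs
    omega
  exact Prod.ext key (Prod.ext hb hc)

theorem exists_isAddable (lam : MultiPartition l) (s : MultiCharge l) (c : Fin l) (x : ℤ)
    (h1 : x - 1 ∈ betaSet (lam c) (s c)) (h2 : x ∉ betaSet (lam c) (s c)) :
    ∃ γ : Node l, IsAddable lam γ ∧ γ.2.2 = c ∧ content s γ = x := by
  obtain ⟨a, ha⟩ := h1
  change rowBead lam s c a = _ at ha
  obtain ⟨mu, hm1, hm2⟩ := exists_setRow lam c a ((lam c).rowLen a + 1) (by
    intro a' ha'
    have := rowBead_lt lam s c ha'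
    -- The bead of row `a - 1` lies to the right of `x - 1` and is not `x`, so that row is strictly
    -- longer than row `a`. All rows above are at least as long.
    have h3 : rowBead lam s c (a - 1) ≠ x := fun h => h2 ⟨_, h⟩
    have h4 := rowBead_lt lam s c (show a - 1 < a by omega)
    have h5 := (lam c).rowLen_anti a' (a - 1) (by omega)
    unfold rowBead at *
    omega) (by
    intro a' ha'
    have := (lam c).rowLen_anti a a' ha'.le
    omega)
  refine ⟨(a, (lam c).rowLen a, c), ⟨?_, mu, nodes_eq_insert hm1 hm2⟩, rfl, ?_⟩
  · rw [mem_nodes_iff]; simp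
  · rw [content]
    unfold rowBead at ha
    dsimp only
    omega

theorem exists_isRemovable (lam : MultiPartition l) (s : MultiCharge l) (c : Fin l) (x : ℤ)
    (h1 : x ∈ betaSet (lam c) (s c)) (h2 : x - 1 ∉ betaSet (lam c) (s c)) :
    ∃ γ : Node l, IsRemovable lam γ ∧ γ.2.2 = c ∧ content s γ = x := by
  obtain ⟨a, ha⟩ := h1
  change rowBead lam s c a = _ at ha
  have h3 : rowBead lam s c (a + 1) ≠ x - 1 := fun h => h2 ⟨_, h⟩
  have h4 := (lam c).rowLen_anti a (a + 1) (by omega)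
  have h5 : (lam c).rowLen (a + 1) < (lam c).rowLen a := by
    unfold rowBead at *
    push_cast at *
    omega
  obtain ⟨mu, hm1, hm2⟩ := exists_setRow lam c a ((lam c).rowLen a - 1) (by
    intro a' ha'
    have := (lam c).rowLen_anti a' a ha'.le
    omega) (by
    intro a' ha'
    have := (lam c).rowLen_anti (a + 1) a' ha'
    omega)
  have hins := nodes_eq_insert (lam := mu) (mu := lam) (a := a) (c := c) (by omega)
    fun a' c' h => (hm2 a' c' h).symm
  have hnot : (a, (mu c).rowLen a, c) ∉ nodes mu := by rw [mem_nodes_iff]; simp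
  refine ⟨(a, (mu c).rowLen a, c), ⟨by simp [hins], mu, ?_⟩, rfl, ?_⟩
  · rw [hins, Set.insert_sdiff_self_of_notMem hnot]
  · rw [content]
    unfold rowBead at ha
    dsimp only
    omega

end Insert

/-! ### The symbol of an `l`-partition -/

/-- The symbol whose Uglov `l`-symbol is the symbol of `(lam, s)`. -/
def bigSymbol (e : ℕ) {l : ℕ} [NeZero e] [NeZero l] (s : MultiCharge l) (lam : MultiPartition l) :
    BetaSymbol :=
  (uglovSplitEquiv e l).symm (multiSymbolEquiv l (lam, s))

/-- The place in the symbol of the position `x` in the component `c` of Uglov's `l`-symbol. -/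
def place (e : ℕ) {l : ℕ} (c : Fin l) (x : ℤ) : ℤ :=
  x % e + e * (c.rev : ℕ) + e * l * (x / e)

section Place

variable {e l : ℕ} [NeZero e]

theorem place_mem [NeZero l] (s : MultiCharge l) (lam : MultiPartition l) (c : Fin l) (x : ℤ) :
    place e c x ∈ (bigSymbol e s lam).1 ↔ x ∈ betaSet (lam c) (s c) := by
  have h : uglovSplitEquiv e l (bigSymbol e s lam) c = multiSymbolEquiv l (lam, s) c := by
    rw [bigSymbol, Equiv.apply_symm_apply]
  exact Set.ext_iff.1 (congrArg Subtype.val h) x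

/-- The dictionary between the two quotients: component `c` and block `k` combine into the height
`c.rev + l k` on runner `i`. -/
theorem place_add (i : ℕ) (hi : i < e) (c : Fin l) (k : ℤ) :
    place e c (i + e * k) = i + e * ((c.rev : ℕ) + l * k) := by
  have he : (e : ℤ) ≠ 0 := by exact_mod_cast NeZero.ne e
  have h1 : ((i : ℤ) + e * k) % e = i := by
    rw [Int.add_mul_emod_self_left, Int.emod_eq_of_lt (by omega) (by omega)]
  have h2 : ((i : ℤ) + e * k) / e = k := by
    rw [Int.add_mul_ediv_left _ _ he, Int.ediv_eq_zero_of_lt (by omega) (by omega), zero_add]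
  rw [place, h1, h2]
  ring

theorem exists_place [NeZero l] (n : ℤ) : ∃ (c : Fin l) (x : ℤ), n = place e c x := by
  have he : (0 : ℤ) < e := by exact_mod_cast Nat.pos_of_ne_zero (NeZero.ne e)
  refine ⟨(residue l (n / e)).rev, (residue e n : ℕ) + e * (n / e / l), ?_⟩
  have h1 := residue_add_ediv l (n / e)
  have h2 := residue_add_ediv e n
  rw [place_add _ (residue e n).2, Fin.rev_rev]
  linear_combination -h2 - e * h1

theorem place_injective [NeZero l] {c c' : Fin l} {x x' : ℤ} (h : place e c x = place e c' x') :
    c = c' ∧ x = x' := by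
  have key : ∀ (c : Fin l) (x : ℤ), place e c x
      = (residue e x : ℕ) + ((c.rev : ℕ) + (x / e) * l) * e := by
    intro c x
    rw [place, residue_val]; ring
  rw [key, key] at h
  have h1 := congrArg (residue e) h
  rw [residue_eq, residue_eq] at h1
  rw [h1] at h
  have he : (e : ℤ) ≠ 0 := by exact_mod_cast NeZero.ne e
  have h2 := mul_right_cancel₀ he (add_left_cancel h)
  have h3 := congrArg (residue l) h2
  rw [residue_eq, residue_eq] at h3
  have h4 := congrArg (· / (l : ℤ)) h2
  rw [ediv_eq, ediv_eq] at h4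
  have h5 := residue_add_ediv e x
  have h6 := residue_add_ediv e x'
  rw [h1, h4] at h5
  exact ⟨Fin.rev_injective h3, h5.symm.trans h6⟩

end Place

/-! ### Signatures in terms of the symbol -/

/-- The position `i + e p` of the symbol. -/
def upPlace (e i : ℕ) (p : ℤ) : ℤ := i + e * p

/-- The position of the symbol from which a bead moves to `upPlace e i p` when an `i`-node is
added. -/
def lowPlace (e l i : ℕ) (p : ℤ) : ℤ :=
  if i = 0 then ((e - 1 : ℕ) : ℤ) + e * (p - l) else ((i - 1 : ℕ) : ℤ) + e * p

theorem upPlace_injective {e : ℕ} [NeZero e] {i : ℕ} {p p' : ℤ}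
    (h : upPlace e i p = upPlace e i p') : p = p' := by
  have he : (e : ℤ) ≠ 0 := by exact_mod_cast NeZero.ne e
  exact mul_left_cancel₀ he (add_left_cancel h)

theorem lowPlace_injective {e l : ℕ} [NeZero e] {i : ℕ} {p p' : ℤ}
    (h : lowPlace e l i p = lowPlace e l i p') : p = p' := by
  have he : (e : ℤ) ≠ 0 := by exact_mod_cast NeZero.ne e
  unfold lowPlace at h
  split_ifs at h
  · exact sub_left_injective (mul_left_cancel₀ he (add_left_cancel h))
  · exact mul_left_cancel₀ he (add_left_cancel h)

theorem add_mul_eq_iff {e : ℕ} {i j : ℕ} (hi : i < e) (hj : j < e) {p q : ℤ} :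
    (i : ℤ) + e * p = j + e * q ↔ i = j ∧ p = q := by
  constructor
  · intro h
    have he : (e : ℤ) ≠ 0 := by omega
    have h1 := congrArg (· % (e : ℤ)) h
    simp only [Int.add_mul_emod_self_left] at h1
    rw [Int.emod_eq_of_lt (by omega) (by omega), Int.emod_eq_of_lt (by omega) (by omega)] at h1
    rw [h1] at h
    exact ⟨by omega, mul_left_cancel₀ he (add_left_cancel h)⟩
  · rintro ⟨rfl, rfl⟩; rfl

/-- The two runners involved have different residues modulo `e`; this is where `2 ≤ e` matters. -/
theorem upPlace_ne_lowPlace {e l : ℕ} {i : ℕ} (he : 2 ≤ e) (hi : i < e) (p p' : ℤ) :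
    upPlace e i p ≠ lowPlace e l i p' := by
  unfold upPlace lowPlace
  split_ifs with h
  · rw [Ne, add_mul_eq_iff hi (by omega)]; omega
  · rw [Ne, add_mul_eq_iff hi (by omega)]; omega

/-- The position of an `i`-node on the runners. -/
def nodePos (e i : ℕ) {l : ℕ} (s : MultiCharge l) (γ : Node l) : ℤ :=
  (γ.2.2.rev : ℕ) + l * ((content s γ - i) / e)

/-- For `i = 0`, the predecessor of `e k` has residue `e - 1` and lies in block `k - 1`. This is the
source of the shift of the height by `l` in `lowPlace`. -/
theorem place_add_sub_one {e l : ℕ} [NeZero e] (i : ℕ) (hi : i < e) (c : Fin l) (k : ℤ) :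
    place e c (i + e * k - 1) = lowPlace e l i ((c.rev : ℕ) + l * k) := by
  rw [lowPlace]
  split_ifs with h0
  · have h2 : (i : ℤ) + e * k - 1 = ((e - 1 : ℕ) : ℤ) + e * (k - 1) := by
      have := Nat.pos_of_ne_zero (NeZero.ne e)
      push_cast [Nat.cast_sub this]
      subst h0
      push_cast
      ring
    rw [h2, place_add (e - 1) (by omega)]
    ring
  · have h2 : (i : ℤ) + e * k - 1 = ((i - 1 : ℕ) : ℤ) + e * k := by
      push_cast [Nat.cast_sub (Nat.pos_of_ne_zero h0)]
      ring
    rw [h2, place_add (i - 1) (by omega)]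

section Signature

variable {e l i : ℕ} (s : MultiCharge l)

theorem content_eq {γ : Node l} (h : content s γ ≡ i [ZMOD e]) :
    content s γ = i + e * ((content s γ - i) / e) := by
  rw [Int.mul_ediv_cancel' h.symm.dvd]; ring

theorem mem_signature {lam : MultiPartition l} {γ : Node l} : γ ∈ signature e s i lam ↔
    (IsAddable lam γ ∨ IsRemovable lam γ) ∧ content s γ ≡ i [ZMOD e] := by
  rw [signature, (List.mergeSort_perm _ _).mem_iff, Finset.mem_toList, Set.Finite.mem_toFinset]
  rfl

variable [NeZero e]

theorem place_content (hi : i < e) {γ : Node l} (h : content s γ ≡ i [ZMOD e]) :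
    place e γ.2.2 (content s γ) = upPlace e i (nodePos e i s γ) := by
  rw [content_eq s h, place_add i hi]
  rfl

theorem place_content_sub_one (hi : i < e) {γ : Node l} (h : content s γ ≡ i [ZMOD e]) :
    place e γ.2.2 (content s γ - 1) = lowPlace e l i (nodePos e i s γ) := by
  rw [content_eq s h, place_add_sub_one i hi]
  rfl

/-- For `i`-nodes, the order by content with ties broken by decreasing component is the order of
`c.rev + l k`, because `c.rev < l`. -/
theorem nodePos_le {γ γ' : Node l} (h : content s γ ≡ i [ZMOD e]) (h' : content s γ' ≡ i [ZMOD e])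
    (hle : NodeLE s γ γ') : nodePos e i s γ ≤ nodePos e i s γ' := by
  have h1 := content_eq s h
  have h2 := content_eq s h'
  unfold nodePos
  set k := (content s γ - i) / e
  set k' := (content s γ' - i) / e
  have he : (0 : ℤ) < e := by exact_mod_cast Nat.pos_of_ne_zero (NeZero.ne e)
  have hr : ((γ.2.2.rev : ℕ) : ℤ) + 1 ≤ l := by have := γ.2.2.rev.2; omega
  rcases hle with hlt | ⟨heq, hc⟩
  · have hk : k + 1 ≤ k' := by
      rw [h1, h2] at hlt
      exact lt_of_mul_lt_mul_left (lt_of_add_lt_add_left hlt) he.le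
    have : (l : ℤ) * (k + 1) ≤ l * k' := mul_le_mul_of_nonneg_left hk (by omega)
    have : (0 : ℤ) ≤ (γ'.2.2.rev : ℕ) := by omega
    linarith
  · have hk : k = k' := by simp only [k, k', heq]
    rw [hk]
    have := Fin.rev_le_rev.2 hc
    have : (γ.2.2.rev : ℕ) ≤ (γ'.2.2.rev : ℕ) := this
    omega

variable [NeZero l]

theorem nodePos_injOn (hi : i < e) {lam : MultiPartition l} {γ γ' : Node l}
    (h : γ ∈ signature e s i lam) (h' : γ' ∈ signature e s i lam)
    (hp : nodePos e i s γ = nodePos e i s γ') : γ = γ' := by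
  rw [mem_signature] at h h'
  have h1 := place_content s hi h.2
  rw [hp, ← place_content s hi h'.2] at h1
  obtain ⟨hc, hs⟩ := place_injective h1
  exact node_unique s h.1 h'.1 hc hs

theorem signature_pairwise (hi : i < e) (lam : MultiPartition l) :
    ((signature e s i lam).map (nodePos e i s)).Pairwise (· < ·) := by
  have h1 : (signature e s i lam).Pairwise fun γ γ' => decide (NodeLE s γ γ') = true := by
    apply List.pairwise_mergeSort
    · intro a b c
      simp only [decide_eq_true_eq]
      unfold NodeLE
      rintro (h | ⟨h, h'⟩) (h2 | ⟨h2, h3⟩)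
      · exact Or.inl (h.trans h2)
      · exact Or.inl (h2 ▸ h)
      · exact Or.inl (h ▸ h2)
      · exact Or.inr ⟨h.trans h2, h3.trans h'⟩
    · intro a b
      rw [Bool.or_eq_true, decide_eq_true_eq, decide_eq_true_eq]
      unfold NodeLE
      rcases lt_trichotomy (content s a) (content s b) with h | h | h
      · exact Or.inl (Or.inl h)
      · exact (le_total b.2.2 a.2.2).imp (fun h' => Or.inr ⟨h, h'⟩) fun h' => Or.inr ⟨h.symm, h'⟩
      · exact Or.inr (Or.inl h)
  have h2 : (signature e s i lam).Nodup := (List.mergeSort_perm _ _).nodup_iff.2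
    (Finset.nodup_toList _)
  rw [List.pairwise_map]
  refine (List.Pairwise.and h1 h2).imp_of_mem ?_
  rintro γ γ' hγ hγ' ⟨hle, hne⟩
  refine lt_of_le_of_ne (nodePos_le s (mem_signature s |>.1 hγ).2 (mem_signature s |>.1 hγ').2
    (of_decide_eq_true hle)) fun h => hne (nodePos_injOn s hi hγ hγ' h)

theorem upPlace_mem (hi : i < e) (lam : MultiPartition l) {γ : Node l}
    (h : content s γ ≡ i [ZMOD e]) :
    upPlace e i (nodePos e i s γ) ∈ (bigSymbol e s lam).1 ↔
      content s γ ∈ betaSet (lam γ.2.2) (s γ.2.2) := by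
  rw [← place_content s hi h, place_mem]

theorem lowPlace_mem (hi : i < e) (lam : MultiPartition l) {γ : Node l}
    (h : content s γ ≡ i [ZMOD e]) :
    lowPlace e l i (nodePos e i s γ) ∈ (bigSymbol e s lam).1 ↔
      content s γ - 1 ∈ betaSet (lam γ.2.2) (s γ.2.2) := by
  rw [← place_content_sub_one s hi h, place_mem]

theorem isRemovable_iff (hi : i < e) {lam : MultiPartition l} {γ : Node l}
    (h : γ ∈ signature e s i lam) :
    IsRemovable lam γ ↔ upPlace e i (nodePos e i s γ) ∈ (bigSymbol e s lam).1 := by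
  obtain ⟨h, hc⟩ := (mem_signature s).1 h
  rw [upPlace_mem s hi lam hc]
  refine ⟨fun h => (h.beads s).1, fun hm => h.resolve_left fun ha => (ha.beads s).2 hm⟩

theorem isAddable_iff (hi : i < e) {lam : MultiPartition l} {γ : Node l}
    (h : γ ∈ signature e s i lam) :
    IsAddable lam γ ↔ upPlace e i (nodePos e i s γ) ∉ (bigSymbol e s lam).1 := by
  obtain ⟨h, hc⟩ := (mem_signature s).1 h
  rw [upPlace_mem s hi lam hc]
  refine ⟨fun h => (h.beads s).2, fun hm => h.resolve_right fun ha => hm (ha.beads s).1⟩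

/-- At height `p` a bead on the lower runner alone is an addable node, and one on the upper runner
alone a removable node. -/
theorem mem_map_signature (hi : i < e) (lam : MultiPartition l) (p : ℤ) :
    p ∈ (signature e s i lam).map (nodePos e i s) ↔
      ¬ (upPlace e i p ∈ (bigSymbol e s lam).1 ↔ lowPlace e l i p ∈ (bigSymbol e s lam).1) := by
  rw [List.mem_map]
  constructor
  · rintro ⟨γ, hγ, rfl⟩
    obtain ⟨h, hc⟩ := (mem_signature s).1 hγ
    rw [upPlace_mem s hi lam hc, lowPlace_mem s hi lam hc]
    rcases h with h | h
    · have := h.beads s; tauto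
    · have := h.beads s; tauto
  · intro hp
    -- Division of `p` by `l` recovers the component from the remainder and the block from the
    -- quotient.
    set c : Fin l := (residue l p).rev with hcdef
    set x : ℤ := i + e * (p / l) with hx
    have hpos : ∀ γ : Node l, γ.2.2 = c → content s γ = x → nodePos e i s γ = p := by
      intro γ h1 h2
      have he : (e : ℤ) ≠ 0 := by exact_mod_cast NeZero.ne e
      rw [nodePos, h1, h2, hcdef, hx, Fin.rev_rev, add_sub_cancel_left,
        Int.mul_ediv_cancel_left _ he]
      have := residue_add_ediv l p
      linarith
    have hmod : ∀ γ : Node l, content s γ = x → content s γ ≡ i [ZMOD e] := by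
      intro γ h
      rw [h, hx]
      exact (Int.modEq_iff_dvd.2 ⟨-(p / l), by ring⟩)
    have hup : upPlace e i p = place e c x := by
      rw [hx, place_add i hi, hcdef, Fin.rev_rev, upPlace]
      have := residue_add_ediv l p
      linear_combination (-(e : ℤ)) * this
    have hlow : lowPlace e l i p = place e c (x - 1) := by
      rw [hx, place_add_sub_one i hi, hcdef, Fin.rev_rev]
      congr 1
      have := residue_add_ediv l p
      linear_combination -this
    rw [hup, hlow, place_mem, place_mem] at hp
    by_cases hxm : x ∈ betaSet (lam c) (s c)
    · obtain ⟨γ, h1, h2, h3⟩ := exists_isRemovable lam s c x hxm (by tauto)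
      exact ⟨γ, (mem_signature s).2 ⟨Or.inr h1, hmod γ h3⟩, hpos γ h2 h3⟩
    · obtain ⟨γ, h1, h2, h3⟩ := exists_isAddable lam s c x (by tauto) hxm
      exact ⟨γ, (mem_signature s).2 ⟨Or.inl h1, hmod γ h3⟩, hpos γ h2 h3⟩

/-- `cancelRA` tests addability and removability separately; on words where they are complementary,
one predicate suffices. -/
theorem cancelRA_eq_cancel {l : ℕ} (lam : MultiPartition l) (w : List (Node l))
    (h : ∀ γ ∈ w, IsAddable lam γ ↔ ¬ IsRemovable lam γ) :
    cancelRA lam w = cancel (IsRemovable lam) w := by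
  induction w with
  | nil => rfl
  | cons γ w ih =>
    have ih := ih fun a ha => h a (by simp [ha])
    have hsub := cancel_sublist (IsRemovable lam) w
    rw [cancelRA, cancel, ih]
    rcases hL : cancel (IsRemovable lam) w with _ | ⟨a, L⟩
    · rfl
    · rw [hL] at hsub
      simp only [h a (by simp [hsub.subset List.mem_cons_self])]

theorem reducedSignature_map (hi : i < e) (lam : MultiPartition l) :
    (reducedSignature e s i lam).map (nodePos e i s) =
      cancel (fun p => upPlace e i p ∈ (bigSymbol e s lam).1)
        ((signature e s i lam).map (nodePos e i s)) := by
  rw [reducedSignature, cancelRA_eq_cancel]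
  · exact cancel_map _ _ _ _ fun γ hγ => isRemovable_iff s hi hγ
  · intro γ hγ
    rw [isAddable_iff s hi hγ, isRemovable_iff s hi hγ]

theorem reducedSignature_subset (hi : i < e) (lam : MultiPartition l) {γ : Node l}
    (h : γ ∈ reducedSignature e s i lam) : γ ∈ signature e s i lam := by
  rw [reducedSignature, cancelRA_eq_cancel] at h
  · exact (cancel_sublist _ _).subset h
  · intro γ hγ
    rw [isAddable_iff s hi hγ, isRemovable_iff s hi hγ]

theorem bigSymbol_of_insert (hi : i < e) {lam mu : MultiPartition l} {γ : Node l}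
    (hc : content s γ ≡ i [ZMOD e]) (hγ : γ ∉ nodes lam) (h : nodes mu = insert γ (nodes lam))
    (n : ℤ) : n ∈ (bigSymbol e s mu).1 ↔ n = upPlace e i (nodePos e i s γ) ∨
      (n ∈ (bigSymbol e s lam).1 ∧ n ≠ lowPlace e l i (nodePos e i s γ)) := by
  obtain ⟨c, x, rfl⟩ := exists_place (e := e) (l := l) n
  have key : ∀ y, place e c x = place e γ.2.2 y ↔ c = γ.2.2 ∧ x = y :=
    fun y => ⟨place_injective, by rintro ⟨rfl, rfl⟩; rfl⟩
  rw [← place_content s hi hc, ← place_content_sub_one s hi hc, place_mem, place_mem, Ne, key, key]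
  exact (beads_of_insert s hγ h).2.2 c x

end Signature

/-! ### Crystal operators on reduced words -/

theorem exists_split_of_pairwise {α : Type*} (R : α → Prop) (L : List α)
    (h : L.Pairwise fun a b => R a → R b) :
    ∃ k ≤ L.length, (∀ p ∈ L.take k, ¬ R p) ∧ ∀ p ∈ L.drop k, R p := by
  induction L with
  | nil => exact ⟨0, le_rfl, by simp, by simp⟩
  | cons a L ih =>
    rw [List.pairwise_cons] at h
    by_cases ha : R a
    · exact ⟨0, Nat.zero_le _, by simp, by simpa using ⟨ha, fun b hb => h.1 b hb ha⟩⟩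
    · obtain ⟨k, hk, h1, h2⟩ := ih h.2
      exact ⟨k + 1, by simpa using hk, by simpa using ⟨ha, h1⟩, by simpa using h2⟩

/-- The symbol `B` arises from `B0` by moves of beads at the positions in `L`, in such a way that
the first `k` positions of `L` are addable in `B`, and the others are removable. -/
structure IsConfig (e l i : ℕ) (L : List ℤ) (B0 : BetaSymbol) (k : ℕ) (B : BetaSymbol) : Prop where
  addable : ∀ p ∈ L.take k, upPlace e i p ∉ B.1 ∧ lowPlace e l i p ∈ B.1
  removable : ∀ p ∈ L.drop k, upPlace e i p ∈ B.1 ∧ lowPlace e l i p ∉ B.1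
  off : ∀ n, (∀ p ∈ L, n ≠ upPlace e i p ∧ n ≠ lowPlace e l i p) → (n ∈ B.1 ↔ n ∈ B0.1)
  charge_eq : charge B = charge B0

section Config

variable {e l i : ℕ} [NeZero e] {L : List ℤ} {B0 B B' : BetaSymbol} {k : ℕ}

theorem mem_take_succ {k : ℕ} (hk : k < L.length) (p : ℤ) :
    p ∈ L.take (k + 1) ↔ p ∈ L.take k ∨ p = L[k] := by
  rw [List.take_succ_eq_append_getElem hk, List.mem_append, List.mem_singleton]

theorem mem_drop {k : ℕ} (hk : k < L.length) (p : ℤ) :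
    p ∈ L.drop k ↔ p = L[k] ∨ p ∈ L.drop (k + 1) := by
  rw [List.drop_eq_getElem_cons hk, List.mem_cons]

theorem getElem_notMem_take (hL : L.Nodup) {k : ℕ} (hk : k < L.length) : L[k] ∉ L.take k := by
  have h2 : (L.take (k + 1)).Nodup := hL.sublist (List.take_sublist _ _)
  rw [List.take_succ_eq_append_getElem hk, List.nodup_append] at h2
  exact fun hm => h2.2.2 _ hm _ (by simp) rfl

theorem getElem_notMem_drop (hL : L.Nodup) {k : ℕ} (hk : k < L.length) :
    L[k] ∉ L.drop (k + 1) := by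
  have h2 : (L.drop k).Nodup := hL.sublist (List.drop_sublist _ _)
  rw [List.drop_eq_getElem_cons hk, List.nodup_cons] at h2
  exact h2.1

/-- The effect of `f̃_i` on the symbol: the last `A`, at index `k`, becomes the first `R`.
Injectivity of the two places keeps all other letters unchanged. -/
theorem IsConfig.move (he : 2 ≤ e) (hi : i < e) (hL : L.Nodup) (hk : k < L.length)
    (h : IsConfig e l i L B0 (k + 1) B)
    (hB : ∀ n, n ∈ B'.1 ↔ n = upPlace e i L[k] ∨ (n ∈ B.1 ∧ n ≠ lowPlace e l i L[k])) :
    IsConfig e l i L B0 k B' := by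
  have hne := upPlace_ne_lowPlace (l := l) he hi
  have hk1 := h.addable _ ((mem_take_succ hk _).2 (Or.inr rfl))
  have key : ∀ p, p ≠ L[k] → (upPlace e i p ∈ B'.1 ↔ upPlace e i p ∈ B.1) ∧
      (lowPlace e l i p ∈ B'.1 ↔ lowPlace e l i p ∈ B.1) := by
    intro p hp
    have h1 : upPlace e i p ≠ upPlace e i L[k] := fun h => hp (upPlace_injective h)
    have h2 : lowPlace e l i p ≠ lowPlace e l i L[k] := fun h => hp (lowPlace_injective h)
    have h3 := hne p L[k]
    have h4 := (hne L[k] p).symm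
    rw [hB, hB]
    tauto
  refine ⟨fun p hp => ?_, fun p hp => ?_, fun n hn => ?_, ?_⟩
  · have hpk : p ≠ L[k] := fun h => getElem_notMem_take hL hk (h ▸ hp)
    rw [(key p hpk).1, (key p hpk).2]
    exact h.addable p ((mem_take_succ hk p).2 (Or.inl hp))
  · by_cases hpk : p = L[k]
    · rw [hpk, hB, hB]
      have := (hne L[k] L[k]).symm
      tauto
    · rw [(key p hpk).1, (key p hpk).2]
      exact h.removable p (((mem_drop hk p).1 hp).resolve_left hpk)
  · have := hn L[k] (List.getElem_mem hk)
    rw [← h.off n hn, hB]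
    tauto
  · rw [← h.charge_eq]
    exact charge_eq_of_move B B' _ _ hk1.2 hk1.1 hB

/-- The effect of `ẽ_i`: the bead at index `k` moves back, and the first `R` becomes the last `A`.
-/
theorem IsConfig.unmove (he : 2 ≤ e) (hi : i < e) (hL : L.Nodup) (hk : k < L.length)
    (h : IsConfig e l i L B0 k B) (hup : upPlace e i L[k] ∉ B'.1)
    (hlow : lowPlace e l i L[k] ∈ B'.1)
    (hB : ∀ n, n ∈ B.1 ↔ n = upPlace e i L[k] ∨ (n ∈ B'.1 ∧ n ≠ lowPlace e l i L[k])) :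
    IsConfig e l i L B0 (k + 1) B' := by
  have hne := upPlace_ne_lowPlace (l := l) he hi
  have key : ∀ p, p ≠ L[k] → (upPlace e i p ∈ B'.1 ↔ upPlace e i p ∈ B.1) ∧
      (lowPlace e l i p ∈ B'.1 ↔ lowPlace e l i p ∈ B.1) := by
    intro p hp
    have h1 : upPlace e i p ≠ upPlace e i L[k] := fun h => hp (upPlace_injective h)
    have h2 : lowPlace e l i p ≠ lowPlace e l i L[k] := fun h => hp (lowPlace_injective h)
    have h3 := hne p L[k]
    have h4 := (hne L[k] p).symm
    rw [hB, hB]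
    tauto
  refine ⟨fun p hp => ?_, fun p hp => ?_, fun n hn => ?_, ?_⟩
  · by_cases hpk : p = L[k]
    · rw [hpk]; exact ⟨hup, hlow⟩
    · rw [(key p hpk).1, (key p hpk).2]
      exact h.addable p (((mem_take_succ hk p).1 hp).resolve_right hpk)
  · have hpk : p ≠ L[k] := fun h => getElem_notMem_drop hL hk (h ▸ hp)
    rw [(key p hpk).1, (key p hpk).2]
    exact h.removable p ((mem_drop hk p).2 (Or.inr hp))
  · have := hn L[k] (List.getElem_mem hk)
    rw [← h.off n hn, hB]
    tauto
  · rw [← h.charge_eq]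
    exact (charge_eq_of_move B' B _ _ hlow hup hB).symm

/-- Symbols in the same family have the same positions of addable and removable nodes, and the
same reduced words. -/
theorem IsConfig.word (he : 2 ≤ e) (hi : i < e) {w : List ℤ} (hw : w.Nodup)
    (hmem : ∀ p, p ∈ w ↔ ¬ (upPlace e i p ∈ B0.1 ↔ lowPlace e l i p ∈ B0.1))
    (hL : L = cancel (fun p => upPlace e i p ∈ B0.1) w) (h : IsConfig e l i L B0 k B) :
    (∀ p, p ∈ w ↔ ¬ (upPlace e i p ∈ B.1 ↔ lowPlace e l i p ∈ B.1)) ∧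
      cancel (fun p => upPlace e i p ∈ B.1) w = L := by
  have hne := upPlace_ne_lowPlace (l := l) he hi
  have key : ∀ p, p ∉ L → (upPlace e i p ∈ B.1 ↔ upPlace e i p ∈ B0.1) ∧
      (lowPlace e l i p ∈ B.1 ↔ lowPlace e l i p ∈ B0.1) := by
    intro p hp
    refine ⟨h.off _ fun q hq => ⟨fun h => ?_, hne p q⟩,
      h.off _ fun q hq => ⟨(hne q p).symm, fun h => ?_⟩⟩
    · exact hp (upPlace_injective h ▸ hq)
    · exact hp (lowPlace_injective h ▸ hq)
  have hsplit := List.take_append_drop k L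
  constructor
  · intro p
    by_cases hp : p ∈ L
    · have hpw : p ∈ w := by rw [hL] at hp; exact (cancel_sublist _ _).subset hp
      rw [← hsplit, List.mem_append] at hp
      have h1 := h.addable p
      have h2 := h.removable p
      tauto
    · rw [hmem, (key p hp).1, (key p hp).2]
  · rw [hL]
    -- Cancelled letters keep their type, and the letters of `L` still form some `A^k R^q`, so the
    -- same pairs cancel.
    apply cancel_eq_of_agree _ _ _ hw
    · intro a _ ha
      exact (key a (hL ▸ ha)).1
    · rw [← hL, ← hsplit, List.pairwise_append]
      refine ⟨List.pairwise_of_forall_mem_list fun a ha b _ hR => absurd hR (h.addable a ha).1,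
        List.pairwise_of_forall_mem_list fun a _ b hb _ => (h.removable b hb).1,
        fun a ha b _ hR => absurd hR (h.addable a ha).1⟩

end Config

theorem ofNodes_spec {l : ℕ} {S : Set (Node l)} (h : ∃ mu : MultiPartition l, nodes mu = S) :
    ∃ mu, ofNodes S = some mu ∧ nodes mu = S :=
  ⟨h.choose, by rw [ofNodes, dif_pos h], h.choose_spec⟩

/-! ### Iterated crystal operators and the action of `σ_i` -/

section Crystal

variable {e l i : ℕ} [NeZero e] [NeZero l] {s : MultiCharge l} {L : List ℤ} {B0 : BetaSymbol}
  {w : List ℤ} {k : ℕ} {lam : MultiPartition l}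

/-- The data of a word of positions and of its reduced word. -/
structure IsWord (e l i : ℕ) (B0 : BetaSymbol) (w L : List ℤ) : Prop where
  pairwise : w.Pairwise (· < ·)
  mem : ∀ p, p ∈ w ↔ ¬ (upPlace e i p ∈ B0.1 ↔ lowPlace e l i p ∈ B0.1)
  reduced : L = cancel (fun p => upPlace e i p ∈ B0.1) w

theorem eq_of_pairwise_lt {w w' : List ℤ} (h : w.Pairwise (· < ·)) (h' : w'.Pairwise (· < ·))
    (hmem : ∀ p, p ∈ w ↔ p ∈ w') : w = w' := by
  have hp : w.Perm w' := (List.perm_ext_iff_of_nodup (h.imp fun h => h.ne)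
    (h'.imp fun h => h.ne)).2 hmem
  exact List.Perm.eq_of_pairwise (fun a b _ _ h1 h2 => absurd h1 (lt_asymm h2)) h h' hp

theorem IsWord.nodup {e l i : ℕ} {B0 : BetaSymbol} {w L : List ℤ} (hW : IsWord e l i B0 w L) :
    L.Nodup := by
  rw [hW.reduced]
  exact (hW.pairwise.sublist (cancel_sublist _ _)).imp fun h => h.ne

/-- All configurations share one reduced word up to the types of its letters, so good nodes can be
read off from `k` alone. -/
theorem IsConfig.map_reducedSignature (he : 2 ≤ e) (hi : i < e) (hW : IsWord e l i B0 w L)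
    (h : IsConfig e l i L B0 k (bigSymbol e s lam)) :
    (reducedSignature e s i lam).map (nodePos e i s) = L := by
  obtain ⟨h1, h2⟩ := h.word he hi (hW.pairwise.imp fun h => h.ne) hW.mem hW.reduced
  rw [reducedSignature_map s hi, eq_of_pairwise_lt (signature_pairwise s hi lam) hW.pairwise, h2]
  intro p
  rw [mem_map_signature s hi, h1]

theorem IsConfig.map_goodAddable (he : 2 ≤ e) (hi : i < e) (hW : IsWord e l i B0 w L)
    (h : IsConfig e l i L B0 k (bigSymbol e s lam)) :
    (goodAddable e s i lam).map (nodePos e i s) = (L.take k).getLast? := by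
  have hL := h.map_reducedSignature he hi hW
  have h1 : L.filter (fun p => decide (upPlace e i p ∉ (bigSymbol e s lam).1)) = L.take k := by
    conv_lhs => rw [← List.take_append_drop k L]
    rw [List.filter_append, List.filter_eq_self.2, List.filter_eq_nil_iff.2, List.append_nil]
    · intro p hp
      simp [(h.removable p hp).1]
    · intro p hp
      simp [(h.addable p hp).1]
  rw [goodAddable, ← List.getLast?_map, ← h1, ← hL, List.filter_map]
  congr 2
  apply List.filter_congr
  intro γ hγ
  simp only [Function.comp, isAddable_iff s hi (reducedSignature_subset s hi lam hγ)]

theorem IsConfig.map_goodRemovable (he : 2 ≤ e) (hi : i < e) (hW : IsWord e l i B0 w L)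
    (h : IsConfig e l i L B0 k (bigSymbol e s lam)) :
    (goodRemovable e s i lam).map (nodePos e i s) = (L.drop k).head? := by
  have hL := h.map_reducedSignature he hi hW
  have h1 : L.filter (fun p => decide (upPlace e i p ∈ (bigSymbol e s lam).1)) = L.drop k := by
    conv_lhs => rw [← List.take_append_drop k L]
    rw [List.filter_append, List.filter_eq_nil_iff.2, List.filter_eq_self.2, List.nil_append]
    · intro p hp
      simp [(h.removable p hp).1]
    · intro p hp
      simp [(h.addable p hp).1]
  rw [goodRemovable, ← List.head?_map, ← h1, ← hL, List.filter_map]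
  congr 2
  apply List.filter_congr
  intro γ hγ
  simp only [Function.comp, isRemovable_iff s hi (reducedSignature_subset s hi lam hγ)]

theorem goodAddable_spec (hi : i < e) {γ : Node l} (h : goodAddable e s i lam = some γ) :
    IsAddable lam γ ∧ content s γ ≡ i [ZMOD e] := by
  have h1 := List.mem_of_getLast? h
  rw [List.mem_filter, decide_eq_true_eq] at h1
  exact ⟨h1.2, ((mem_signature s).1 (reducedSignature_subset s hi lam h1.1)).2⟩

theorem goodRemovable_spec (hi : i < e) {γ : Node l} (h : goodRemovable e s i lam = some γ) :
    IsRemovable lam γ ∧ content s γ ≡ i [ZMOD e] := by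
  have h1 := List.mem_of_head? h
  rw [List.mem_filter, decide_eq_true_eq] at h1
  exact ⟨h1.2, ((mem_signature s).1 (reducedSignature_subset s hi lam h1.1)).2⟩

theorem IsConfig.fTilde_eq_none (he : 2 ≤ e) (hi : i < e) (hW : IsWord e l i B0 w L)
    (h : IsConfig e l i L B0 0 (bigSymbol e s lam)) : fTilde e s i lam = none := by
  have h1 := h.map_goodAddable he hi hW
  rw [List.take_zero, List.getLast?_nil, Option.map_eq_none_iff] at h1
  rw [fTilde, h1, Option.bind_none]

theorem IsConfig.eTilde_eq_none (he : 2 ≤ e) (hi : i < e) (hW : IsWord e l i B0 w L)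
    (h : IsConfig e l i L B0 L.length (bigSymbol e s lam)) : eTilde e s i lam = none := by
  have h1 := h.map_goodRemovable he hi hW
  rw [List.drop_length, List.head?_nil, Option.map_eq_none_iff] at h1
  rw [eTilde, h1, Option.bind_none]

theorem IsConfig.fTilde_eq_some (he : 2 ≤ e) (hi : i < e) (hW : IsWord e l i B0 w L)
    (hk : k < L.length) (h : IsConfig e l i L B0 (k + 1) (bigSymbol e s lam)) :
    ∃ mu, fTilde e s i lam = some mu ∧ IsConfig e l i L B0 k (bigSymbol e s mu) := by
  have h1 := h.map_goodAddable he hi hW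
  rw [List.take_succ_eq_append_getElem hk, List.getLast?_append, List.getLast?_singleton,
    Option.some_or, Option.map_eq_some_iff] at h1
  obtain ⟨γ, hγ, hpos⟩ := h1
  obtain ⟨⟨hn, hex⟩, hc⟩ := goodAddable_spec hi hγ
  obtain ⟨mu, hmu, hnodes⟩ := ofNodes_spec hex
  refine ⟨mu, by rw [fTilde, hγ, Option.bind_some, hmu], h.move he hi hW.nodup hk ?_⟩
  rw [← hpos]
  exact bigSymbol_of_insert s hi hc hn hnodes

theorem IsConfig.eTilde_eq_some (he : 2 ≤ e) (hi : i < e) (hW : IsWord e l i B0 w L)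
    (hk : k < L.length) (h : IsConfig e l i L B0 k (bigSymbol e s lam)) :
    ∃ mu, eTilde e s i lam = some mu ∧ IsConfig e l i L B0 (k + 1) (bigSymbol e s mu) := by
  have h1 := h.map_goodRemovable he hi hW
  rw [List.drop_eq_getElem_cons hk, List.head?_cons, Option.map_eq_some_iff] at h1
  obtain ⟨γ, hγ, hpos⟩ := h1
  obtain ⟨hr, hc⟩ := goodRemovable_spec hi hγ
  obtain ⟨mu, hmu, hnodes⟩ := ofNodes_spec hr.2
  have hn : γ ∉ nodes mu := by simp [hnodes]
  have hins : nodes lam = insert γ (nodes mu) := by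
    rw [hnodes, Set.insert_sdiff_singleton, Set.insert_eq_of_mem hr.1]
  have hb := beads_of_insert s hn hins
  refine ⟨mu, by rw [eTilde, hγ, Option.bind_some, hmu], h.unmove he hi hW.nodup hk ?_ ?_ ?_⟩
  · rw [← hpos, upPlace_mem s hi mu hc]
    exact hb.2.1
  · rw [← hpos, lowPlace_mem s hi mu hc]
    exact hb.1
  · rw [← hpos]
    exact bigSymbol_of_insert s hi hc hn hins

/-- Iteration of a partially defined operator that lowers a counter. -/
theorem iterate_bind_spec {α : Type*} (f : α → Option α) (P : ℕ → α → Prop)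
    (h0 : ∀ x, P 0 x → f x = none) (hs : ∀ k x, P (k + 1) x → ∃ y, f x = some y ∧ P k y)
    (k : ℕ) (x : α) (hx : P k x) :
    (∀ j ≤ k, ∃ y, (fun o : Option α => o.bind f)^[j] (some x) = some y ∧ P (k - j) y) ∧
      sSup {j : ℕ | (fun o : Option α => o.bind f)^[j] (some x) ≠ none} = k := by
  have hnone : ∀ j, (fun o : Option α => o.bind f)^[j] none = none := by
    intro j
    induction j with
    | zero => rfl
    | succ j ih => rw [Function.iterate_succ_apply]; exact ih
  have h1 : ∀ j k x, P k x → j ≤ k →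
      ∃ y, (fun o : Option α => o.bind f)^[j] (some x) = some y ∧ P (k - j) y := by
    intro j
    induction j with
    | zero => exact fun k x hx _ => ⟨x, rfl, hx⟩
    | succ j ih =>
      intro k x hx hj
      obtain ⟨k, rfl⟩ : ∃ k', k = k' + 1 := ⟨k - 1, by omega⟩
      obtain ⟨y, hy, hP⟩ := hs k x hx
      obtain ⟨z, hz, hz'⟩ := ih k y hP (by omega)
      refine ⟨z, ?_, by rwa [Nat.add_sub_add_right]⟩
      rw [Function.iterate_succ_apply, Option.bind_some, hy, hz]
  have h2 : ∀ k x, P k x → ∀ j, k < j → (fun o : Option α => o.bind f)^[j] (some x) = none := by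
    intro k
    induction k with
    | zero =>
      intro x hx j hj
      obtain ⟨j, rfl⟩ : ∃ j', j = j' + 1 := ⟨j - 1, by omega⟩
      rw [Function.iterate_succ_apply, Option.bind_some, h0 x hx, hnone]
    | succ k ih =>
      intro x hx j hj
      obtain ⟨j, rfl⟩ : ∃ j', j = j' + 1 := ⟨j - 1, by omega⟩
      obtain ⟨y, hy, hP⟩ := hs k x hx
      rw [Function.iterate_succ_apply, Option.bind_some, hy, ih y hP j (by omega)]
  refine ⟨fun j hj => h1 j k x hx hj, ?_⟩
  have : {j : ℕ | (fun o : Option α => o.bind f)^[j] (some x) ≠ none} = Set.Iic k := by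
    ext j
    rw [Set.mem_Iic]
    constructor
    · intro hj
      by_contra hlt
      exact hj (h2 k x hx j (not_le.1 hlt))
    · intro hj
      obtain ⟨y, hy, -⟩ := h1 j k x hx hj
      change _ ≠ none
      rw [hy]
      simp
  rw [this, csSup_Iic]

theorem IsConfig.sigmaStar_eq (he : 2 ≤ e) (hi : i < e) (hW : IsWord e l i B0 w L)
    (hk : k ≤ L.length) (h : IsConfig e l i L B0 k (bigSymbol e s lam)) :
    ∃ mu, sigmaStar e s i lam = some mu ∧
      IsConfig e l i L B0 (L.length - k) (bigSymbol e s mu) := by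
  obtain ⟨f1, f2⟩ := iterate_bind_spec (fTilde e s i)
    (fun k mu => k ≤ L.length ∧ IsConfig e l i L B0 k (bigSymbol e s mu))
    (fun mu hmu => hmu.2.fTilde_eq_none he hi hW)
    (fun k mu hmu => by
      obtain ⟨nu, h1, h2⟩ := hmu.2.fTilde_eq_some he hi hW (by omega)
      exact ⟨nu, h1, by omega, h2⟩) k lam ⟨hk, h⟩
  -- The counter is the number `q` of remaining letters `R`, so the configuration has index
  -- `L.length - q`.
  obtain ⟨e1, e2⟩ := iterate_bind_spec (eTilde e s i)
    (fun q mu => q ≤ L.length ∧ IsConfig e l i L B0 (L.length - q) (bigSymbol e s mu))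
    (fun mu hmu => hmu.2.eTilde_eq_none he hi hW)
    (fun q mu hmu => by
      obtain ⟨nu, h1, h2⟩ := hmu.2.eTilde_eq_some he hi hW (by omega)
      refine ⟨nu, h1, by omega, ?_⟩
      rwa [show L.length - (q + 1) + 1 = L.length - q by omega] at h2) (L.length - k) lam
    ⟨by omega, by rwa [show L.length - (L.length - k) = k by omega]⟩
  have hε : epsilon e s i lam = k := f2
  have hφ : phi e s i lam = L.length - k := e2
  rw [sigmaStar, hε, hφ]
  -- With `q = L.length - k`, either `q - k` removals raise the number of letters `A` from `k` to
  -- `q`, or `k - q` additions lower it to `q`.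
  split_ifs with hle
  · obtain ⟨mu, h1, -, h2⟩ := e1 (L.length - k - k) (by omega)
    refine ⟨mu, h1, ?_⟩
    rwa [show L.length - (L.length - k - (L.length - k - k)) = L.length - k by omega] at h2
  · obtain ⟨mu, h1, -, h2⟩ := f1 (k - (L.length - k)) (by omega)
    refine ⟨mu, h1, ?_⟩
    rwa [show k - (k - (L.length - k)) = L.length - k by omega] at h2

/-- The crystal action of `σ_i` is the exchange algorithm on two runners of the symbol. -/
theorem sigmaStar_eq_exchange (he : 2 ≤ e) (hi : i < e) (s : MultiCharge l)
    (lam : MultiPartition l) (Y X : BetaSymbol)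
    (hY : ∀ p, p ∈ Y.1 ↔ lowPlace e l i p ∈ (bigSymbol e s lam).1)
    (hX : ∀ p, p ∈ X.1 ↔ upPlace e i p ∈ (bigSymbol e s lam).1) :
    ∃ mu, sigmaStar e s i lam = some mu ∧
      charge (bigSymbol e s mu) = charge (bigSymbol e s lam) ∧
      (∀ p, p ∈ (exchange Y X).1.1 ↔ lowPlace e l i p ∈ (bigSymbol e s mu).1) ∧
      (∀ p, p ∈ (exchange Y X).2.1 ↔ upPlace e i p ∈ (bigSymbol e s mu).1) ∧
      ∀ n, (∀ p, n ≠ upPlace e i p ∧ n ≠ lowPlace e l i p) →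
        (n ∈ (bigSymbol e s mu).1 ↔ n ∈ (bigSymbol e s lam).1) := by
  set B0 := bigSymbol e s lam with hB0
  set w := (signature e s i lam).map (nodePos e i s)
  set L := cancel (fun p => upPlace e i p ∈ B0.1) w with hL
  have hW : IsWord e l i B0 w L :=
    ⟨signature_pairwise s hi lam, mem_map_signature s hi lam, rfl⟩
  have hLw : ∀ p ∈ L, p ∈ w := fun p hp => (cancel_sublist _ _).subset hp
  obtain ⟨k, hk, hA, hR⟩ := exists_split_of_pairwise (fun p => upPlace e i p ∈ B0.1) L
    (cancel_pairwise _ w)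
  have hconf : IsConfig e l i L B0 k B0 := by
    refine ⟨fun p hp => ?_, fun p hp => ?_, fun n _ => Iff.rfl, rfl⟩
    · have h1 := (hW.mem p).1 (hLw p (List.mem_of_mem_take hp))
      have h2 := hA p hp
      tauto
    · have h1 := (hW.mem p).1 (hLw p (List.mem_of_mem_drop hp))
      have h2 := hR p hp
      tauto
  obtain ⟨mu, hmu, hc⟩ := hconf.sigmaStar_eq he hi hW hk
  have hcancel : cancel (· ∈ X.1) w = L := by
    rw [hL]
    congr 1
    funext p
    exact propext (hX p)
  -- The exchange places the lower beads at the first `L.length - k` positions of `L` and the upper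
  -- beads at the others, which is the configuration reached by the crystal action.
  have hex := mem_exchange Y X w hW.pairwise (fun p => by rw [hW.mem, hX, hY]) k (L.length - k)
    (by rw [hcancel]; omega) (by rw [hcancel]; exact fun p hp => by rw [hX]; exact hA p hp)
    (by rw [hcancel]; exact fun p hp => by rw [hX]; exact hR p hp)
  rw [hcancel] at hex
  have hne := upPlace_ne_lowPlace (l := l) he hi
  have hoff : ∀ p, p ∉ L → (upPlace e i p ∈ (bigSymbol e s mu).1 ↔ upPlace e i p ∈ B0.1) ∧
      (lowPlace e l i p ∈ (bigSymbol e s mu).1 ↔ lowPlace e l i p ∈ B0.1) := by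
    intro p hp
    refine ⟨hc.off _ fun q hq => ⟨fun h => ?_, hne p q⟩,
      hc.off _ fun q hq => ⟨(hne q p).symm, fun h => ?_⟩⟩
    · exact hp (upPlace_injective h ▸ hq)
    · exact hp (lowPlace_injective h ▸ hq)
  have hmemL : ∀ p, p ∈ L ↔ p ∈ L.take (L.length - k) ∨ p ∈ L.drop (L.length - k) := by
    intro p
    rw [← List.mem_append, List.take_append_drop]
  refine ⟨mu, hmu, hc.charge_eq, fun p => ?_, fun p => ?_, fun n hn => hc.off n fun p _ => hn p⟩
  · rw [(hex p).1, hY]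
    by_cases hp : p ∈ L
    · by_cases ht : p ∈ L.take (L.length - k)
      · exact iff_of_true (Or.inl ht) (hc.addable p ht).2
      · refine iff_of_false ?_ (hc.removable p (((hmemL p).1 hp).resolve_left ht)).2
        exact fun h => h.elim ht fun h => h.1 hp
    · rw [(hoff p hp).2]
      exact ⟨fun h => (h.resolve_left fun h => hp (List.mem_of_mem_take h)).2,
        fun h => Or.inr ⟨hp, h⟩⟩
  · rw [(hex p).2, hX]
    by_cases hp : p ∈ L
    · by_cases ht : p ∈ L.drop (L.length - k)
      · exact iff_of_true (Or.inl ht) (hc.removable p ht).1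
      · refine iff_of_false ?_ (hc.addable p (((hmemL p).1 hp).resolve_right ht)).1
        exact fun h => h.elim ht fun h => h.1 hp
    · rw [(hoff p hp).1]
      exact ⟨fun h => (h.resolve_left fun h => hp (List.mem_of_mem_drop h)).2,
        fun h => Or.inr ⟨hp, h⟩⟩

end Crystal

/-! ### The `e`-quotient -/

theorem betaSet_add (lam : YoungDiagram) (m d k : ℤ) :
    k ∈ betaSet lam (m + d) ↔ k - d ∈ betaSet lam m := by
  constructor <;> (rintro ⟨a, ha⟩; refine ⟨a, ?_⟩; dsimp only at ha ⊢; omega)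

theorem charge_toSymbol (lam : YoungDiagram) (m : ℤ) : charge (toSymbol (lam, m)) = m :=
  congrArg Prod.snd (symbolEquiv.symm_apply_apply (lam, m))

section Quotient

variable {e : ℕ}

theorem multiSymbolEquiv_apply (lam : MultiPartition e) (s : MultiCharge e) (j : Fin e) :
    multiSymbolEquiv e (lam, s) j = toSymbol (lam j, s j) := rfl

/-- The bijection `Ψ` on symbols. -/
theorem multiSymbolEquiv_psi {i : ℕ} (hi : 1 ≤ i) (hie : i < e) (s : MultiCharge e)
    (lam : MultiPartition e) (p q : Fin e) (hp : (p : ℕ) = i - 1) (hq : (q : ℕ) = i) :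
    multiSymbolEquiv e (psi i hi hie s lam, sigmaCharge i hi hie s) =
      Function.update (Function.update (multiSymbolEquiv e (lam, s)) p
        (exchange (multiSymbolEquiv e (lam, s) p) (multiSymbolEquiv e (lam, s) q)).1) q
        (exchange (multiSymbolEquiv e (lam, s) p) (multiSymbolEquiv e (lam, s) q)).2 := by
  obtain rfl : p = ⟨i - 1, (Nat.sub_le _ _).trans_lt hie⟩ := Fin.ext hp
  obtain rfl : q = ⟨i, hie⟩ := Fin.ext hq
  have hpq : (⟨i - 1, by omega⟩ : Fin e) ≠ ⟨i, hie⟩ := by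
    intro h
    have := congrArg Fin.val h
    dsimp only at this
    omega
  rw [← Equiv.eq_symm_apply]
  -- The partitions agree by the definition of `psi`, so only the charges of the exchanged symbols
  -- have to be compared.
  refine Prod.ext rfl ?_
  funext j
  change s (Equiv.swap _ _ j) = charge
    (Function.update (β := fun _ => BetaSymbol) (Function.update _ _ _) _ _ j)
  have hex := charge_exchange (multiSymbolEquiv e (lam, s) ⟨i - 1, by omega⟩)
    (multiSymbolEquiv e (lam, s) ⟨i, hie⟩)
  by_cases h1 : j = ⟨i, hie⟩
  · rw [h1, Equiv.swap_apply_right, Function.update_self, hex.2, multiSymbolEquiv_apply,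
      charge_toSymbol]
  · by_cases h2 : j = ⟨i - 1, by omega⟩
    · rw [h2, Equiv.swap_apply_left, Function.update_of_ne hpq, Function.update_self, hex.1,
        multiSymbolEquiv_apply, charge_toSymbol]
    · rw [Equiv.swap_apply_of_ne_of_ne h2 h1, Function.update_of_ne h1, Function.update_of_ne h2,
        multiSymbolEquiv_apply, charge_toSymbol]

variable [NeZero e]

theorem tauE_symm_eq (lam : MultiPartition e) (s : MultiCharge e) (B : BetaSymbol)
    (h : ∀ (j : Fin e) (k : ℤ), k ∈ (multiSymbolEquiv e (lam, s) j).1 ↔ (j : ℤ) + e * k ∈ B.1) :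
    (tauE e).symm (lam, s) = symbolEquiv.symm B := by
  change symbolEquiv.symm ((splitEquiv e).symm (multiSymbolEquiv e (lam, s))) = _
  congr 1
  rw [Equiv.symm_apply_eq]
  funext j
  apply Subtype.ext
  ext k
  rw [h, mul_comm]
  rfl

theorem mem_of_tauE_eq {lam : YoungDiagram} {m : ℤ} {lamE : MultiPartition e}
    {sE : MultiCharge e} (h : tauE e (lam, m) = (lamE, sE)) (j : Fin e) (k : ℤ) :
    k ∈ betaSet (lamE j) (sE j) ↔ (j : ℤ) + e * k ∈ (toSymbol (lam, m)).1 := by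
  have h1 : multiSymbolEquiv e (lamE, sE) = splitEquiv e (toSymbol (lam, m)) := by
    rw [← h]
    exact Equiv.apply_symm_apply _ _
  have h2 := Set.ext_iff.1 (congrArg Subtype.val (congrFun h1 j)) k
  rw [mul_comm]
  exact h2

theorem val_add_one (he : 2 ≤ e) (j : Fin e) :
    ((j + 1 : Fin e) : ℕ) = if (j : ℕ) = e - 1 then 0 else (j : ℕ) + 1 := by
  have h1 : ((1 : Fin e) : ℕ) = 1 := by
    rw [Fin.val_one', Nat.mod_eq_of_lt (by omega)]
  rw [Fin.val_add, h1]
  have := j.2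
  split_ifs with h
  · rw [h, show e - 1 + 1 = e by omega, Nat.mod_self]
  · exact Nat.mod_eq_of_lt (by omega)

theorem val_neg_one (he : 2 ≤ e) : ((-1 : Fin e) : ℕ) = e - 1 := by
  have h := val_add_one he (-1)
  rw [neg_add_cancel, Fin.val_zero] at h
  split_ifs at h with h1
  exact h1

end Quotient

theorem exists_tauL_symm_eq {e l : ℕ} [NeZero e] [NeZero l] {m : ℤ} {mu : MultiPartition l}
    {s : MultiCharge l} (h : charge (bigSymbol e s mu) = m) :
    (tauL e l).symm (mu, s) = ((symbolEquiv.symm (bigSymbol e s mu)).1, m) :=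
  Prod.ext rfl h

theorem bigSymbol_eq_of_tauL_eq {e l : ℕ} [NeZero e] [NeZero l] {lam : YoungDiagram} {m : ℤ}
    {lamL : MultiPartition l} {sL : MultiCharge l} (h : tauL e l (lam, m) = (lamL, sL)) :
    bigSymbol e sL lamL = toSymbol (lam, m) := by
  have h1 : symbolEquiv.symm (bigSymbol e sL lamL) = (lam, m) :=
    (Equiv.symm_apply_eq (tauL e l)).2 h.symm
  exact (Equiv.symm_apply_eq _).1 h1

/-! ### The cases `i ≥ 1` and `i = 0` -/

section Main

variable {e l : ℕ} [NeZero e] [NeZero l] {lam : YoungDiagram} {m : ℤ} {lamL : MultiPartition l}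
  {sL : MultiCharge l} {lamE : MultiPartition e} {sE : MultiCharge e}

/-- For `i ≥ 1` the lower and upper places are literally components `i - 1` and `i` of the
`e`-symbol, so both sides yield `bigSymbol e sL mu`. -/
theorem sigmaStar_pos (he : 2 ≤ e) (hL : tauL e l (lam, m) = (lamL, sL))
    (hE : tauE e (lam, m) = (lamE, sE)) (i : ℕ) (hi : 1 ≤ i) (hie : i < e) :
    ∃ (mu : MultiPartition l) (nu : YoungDiagram), sigmaStar e sL i lamL = some mu ∧
      (tauL e l).symm (mu, sL) = (nu, m) ∧
      (tauE e).symm (psi i hi hie sE lamE, sigmaCharge i hi hie sE) = (nu, m) := by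
  have hB := bigSymbol_eq_of_tauL_eq hL
  have hlow : ∀ p, lowPlace e l i p = ((i - 1 : ℕ) : ℤ) + e * p := fun p => by
    rw [lowPlace, if_neg (by omega)]
  set p : Fin e := ⟨i - 1, by omega⟩ with hp
  set q : Fin e := ⟨i, hie⟩ with hq
  have hpq : p ≠ q := by
    intro h
    have := congrArg Fin.val h
    simp only [hp, hq] at this
    omega
  obtain ⟨mu, h1, h2, h3, h4, h5⟩ := sigmaStar_eq_exchange he hie sL lamL
    (multiSymbolEquiv e (lamE, sE) p) (multiSymbolEquiv e (lamE, sE) q)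
    (fun k => by rw [hB, hlow]; exact mem_of_tauE_eq hE p k)
    (fun k => by rw [hB]; exact mem_of_tauE_eq hE q k)
  have hm : charge (bigSymbol e sL mu) = m := by rw [h2, hB, charge_toSymbol]
  refine ⟨mu, _, h1, exists_tauL_symm_eq hm, ?_⟩
  rw [tauE_symm_eq (B := bigSymbol e sL mu)]
  · exact exists_tauL_symm_eq hm
  · intro j k
    rw [multiSymbolEquiv_psi hi hie sE lamE p q rfl rfl]
    by_cases hjq : j = q
    · rw [hjq, Function.update_self, h4]
      rfl
    · rw [Function.update_of_ne hjq]
      by_cases hjp : j = p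
      · rw [hjp, Function.update_self, h3, hlow]
      · rw [Function.update_of_ne hjp, h5, hB]
        · exact mem_of_tauE_eq hE j k
        · intro k'
          rw [hlow, upPlace, Ne, Ne, add_mul_eq_iff j.2 hie, add_mul_eq_iff j.2 (by omega)]
          exact ⟨fun h => hjq (Fin.ext h.1), fun h => hjp (Fin.ext h.1)⟩

/-- The twist `∗` puts runner `e - 1`, raised by `l`, directly before runner `0`, so that `σ_0`
becomes an exchange of components `0` and `1`. The twist `△` and `σ_0.s` undo the rotation and the
shift. -/
theorem sigmaStar_zero (he : 2 ≤ e) (hL : tauL e l (lam, m) = (lamL, sL))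
    (hE : tauE e (lam, m) = (lamE, sE)) :
    ∃ (mu : MultiPartition l) (nu : YoungDiagram), sigmaStar e sL 0 lamL = some mu ∧
      (tauL e l).symm (mu, sL) = (nu, m) ∧
      (tauE e).symm (twistTriangle (psi 1 le_rfl he (chargeStar l sE) (twistStar lamE)),
        sigmaZeroCharge l sE) = (nu, m) := by
  have hB := bigSymbol_eq_of_tauL_eq hL
  have hlow : ∀ p, lowPlace e l 0 p = ((e - 1 : ℕ) : ℤ) + e * (p - l) := fun p => by
    rw [lowPlace, if_pos rfl]
  have hup : ∀ p, upPlace e 0 p = ((0 : ℕ) : ℤ) + e * p := fun p => rfl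
  have hneg : ((-1 : Fin e) : ℕ) = e - 1 := val_neg_one he
  have h01 : ((0 + 1 : Fin e) : ℕ) = 1 := by
    rw [val_add_one he, if_neg (by rw [Fin.val_zero]; omega), Fin.val_zero]
  have hne1 : (0 + 1 : Fin e) ≠ 0 := by
    intro h
    rw [h, Fin.val_zero] at h01
    omega
  have hne2 : (0 : Fin e) ≠ -1 := by
    intro h
    rw [← h, Fin.val_zero] at hneg
    omega
  set Z := multiSymbolEquiv e (twistStar lamE, chargeStar l sE) with hZ
  have hZ0 : ∀ k, k ∈ (Z 0).1 ↔ lowPlace e l 0 k ∈ (bigSymbol e sL lamL).1 := by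
    intro k
    change k ∈ betaSet (twistStar lamE 0) (chargeStar l sE 0) ↔ _
    rw [twistStar, chargeStar, if_pos rfl, zero_sub, betaSet_add, mem_of_tauE_eq hE, hneg, hB,
      hlow]
  have hZs : ∀ j : Fin e, j ≠ -1 → Z (j + 1) = toSymbol (lamE j, sE j) := by
    intro j hj
    have hj1 : j + 1 ≠ 0 := fun h => hj (eq_neg_of_add_eq_zero_left h)
    rw [hZ, multiSymbolEquiv_apply, twistStar, chargeStar, if_neg hj1, add_sub_cancel_right]
  obtain ⟨mu, h1, h2, h3, h4, h5⟩ := sigmaStar_eq_exchange he (i := 0) (by omega) sL lamL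
    (Z 0) (Z (0 + 1)) hZ0 (fun k => by
      rw [hZs 0 hne2, hB, hup]
      exact (mem_of_tauE_eq hE 0 k).trans (by rw [Fin.val_zero]))
  have hm : charge (bigSymbol e sL mu) = m := by rw [h2, hB, charge_toSymbol]
  refine ⟨mu, _, h1, exists_tauL_symm_eq hm, ?_⟩
  rw [tauE_symm_eq (B := bigSymbol e sL mu)]
  · exact exists_tauL_symm_eq hm
  · intro j k
    have hU := multiSymbolEquiv_psi le_rfl he (chargeStar l sE) (twistStar lamE) 0 (0 + 1)
      (by rw [Fin.val_zero]) h01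
    rw [← hZ] at hU
    -- the components of the exchanged symbol and their charges
    set P := psi 1 le_rfl he (chargeStar l sE) (twistStar lamE) with hP
    have hUj := congrFun hU (j + 1)
    rw [multiSymbolEquiv_apply] at hUj
    have hp0 : (⟨1 - 1, by omega⟩ : Fin e) = 0 := Fin.ext (by rw [Fin.val_zero])
    have hq1 : (⟨1, he⟩ : Fin e) = 0 + 1 := Fin.ext h01.symm
    rw [sigmaCharge, hp0, hq1] at hUj
    rw [multiSymbolEquiv_apply]
    change k ∈ betaSet (P (j + 1)) (sigmaZeroCharge l sE j) ↔ _
    -- Here `c` is the difference between the charge in `σ_0.s` and the charge after the exchange.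
    -- It is `-l` for the last component, which is lowered again, and `0` for all others.
    have hmemU : ∀ c, sigmaZeroCharge l sE j
        = chargeStar l sE (Equiv.swap 0 (0 + 1) (j + 1)) + c →
        (k ∈ betaSet (P (j + 1)) (sigmaZeroCharge l sE j) ↔ k - c ∈
          (Function.update (Function.update Z 0 (exchange (Z 0) (Z (0 + 1))).1) (0 + 1)
            (exchange (Z 0) (Z (0 + 1))).2 (j + 1)).1) := by
      intro c hc
      rw [hc, betaSet_add, ← hUj]
      rfl
    by_cases hj0 : j = 0
    · subst hj0
      rw [hmemU 0, Function.update_self, sub_zero, h4, hup, Fin.val_zero]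
      rw [Equiv.swap_apply_right, sigmaZeroCharge, chargeStar, if_pos rfl, if_pos rfl, add_zero]
    · by_cases hj1 : j = -1
      · have hj2 : j + 1 = 0 := by rw [hj1, neg_add_cancel]
        rw [hmemU (-l), hj2, Function.update_of_ne hne1.symm, Function.update_self, h3, hlow, hj1,
          hneg]
        · rw [show k - -(l : ℤ) - l = k by ring]
        · rw [hj2, Equiv.swap_apply_left, sigmaZeroCharge, if_neg hj0, if_pos hj1, chargeStar,
            if_neg hne1, add_sub_cancel_right]
          ring
      · have hj2 : j + 1 ≠ 0 := fun h => hj1 (eq_neg_of_add_eq_zero_left h)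
        have hj3 : j + 1 ≠ 0 + 1 := fun h => hj0 (add_right_cancel h)
        rw [hmemU 0, Function.update_of_ne hj3, Function.update_of_ne hj2, hZs j hj1, sub_zero, h5,
          hB]
        · exact mem_of_tauE_eq hE j k
        · intro k'
          rw [hlow, hup, Ne, Ne, add_mul_eq_iff j.2 (by omega), add_mul_eq_iff j.2 (by omega)]
          exact ⟨fun h => hj0 (Fin.ext (by rw [h.1, Fin.val_zero])),
            fun h => hj1 (Fin.ext (by rw [h.1, hneg]))⟩
        · rw [Equiv.swap_apply_of_ne_of_ne hj2 hj3, sigmaZeroCharge, if_neg hj0, if_neg hj1,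
            chargeStar, if_neg hj2, add_sub_cancel_right, add_zero]

end Main

end LevelRank

end

theorem mainTheorem1 (e l : ℕ) [NeZero e] [NeZero l] (he : 2 ≤ e)
    (lam : YoungDiagram) (m : ℤ)
    (lamL : LevelRank.MultiPartition l) (sL : LevelRank.MultiCharge l)
    (lamE : LevelRank.MultiPartition e) (sE : LevelRank.MultiCharge e)
    (hL : LevelRank.tauL e l (lam, m) = (lamL, sL))
    (hE : LevelRank.tauE e (lam, m) = (lamE, sE))
    (hU : LevelRank.IsUglov e sL lamL) :
    (∀ (i : ℕ) (hi : 1 ≤ i) (hie : i < e),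
      ∃ (mu : LevelRank.MultiPartition l) (nu : YoungDiagram),
        LevelRank.sigmaStar e sL i lamL = some mu ∧
        (LevelRank.tauL e l).symm (mu, sL) = (nu, m) ∧
        (LevelRank.tauE e).symm
          (LevelRank.psi i hi hie sE lamE, LevelRank.sigmaCharge i hi hie sE) = (nu, m)) ∧
    ∃ (mu : LevelRank.MultiPartition l) (nu : YoungDiagram),
      LevelRank.sigmaStar e sL 0 lamL = some mu ∧
      (LevelRank.tauL e l).symm (mu, sL) = (nu, m) ∧
      (LevelRank.tauE e).symm
        (LevelRank.twistTriangle
          (LevelRank.psi 1 le_rfl he (LevelRank.chargeStar l sE) (LevelRank.twistStar lamE)),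
          LevelRank.sigmaZeroCharge l sE) = (nu, m) :=
  ⟨fun i hi hie => LevelRank.sigmaStar_pos he hL hE i hi hie, LevelRank.sigmaStar_zero he hL hE⟩
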